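/- Let $\theta>0$, let $n$ be a positive integer, $w=\theta/n$, $u=e^{-w}$. For $1\le m\le n$ let $R_{\theta,n;m}$ be the $m\times m$ matrix with $(k,l)$ entry $(1+|k-l|w)u^{|k-l|}$, and $R_{\theta,n}=R_{\theta,n;n}$. For $1\le i,j\le n$ let $R_{\theta,n;-i,-j}$ be $R_{\theta,n}$ with row $i$ and column $j$ deleted, and for $1\le m\le n-1$ let $R_{\theta,n;-i,-j;m}$ be its leading $m\times m$ block (so $R_{\theta,n;-i,-j;n-1}=R_{\theta,n;-i,-j}$). Write $|\cdot|$ for the determinant. Put $$\tau_{-1}=(w-1)u+(1+w)u^3,$$ $$\hat\tau_{-2}=2\tau_{-1}u,\qquad \hat\tau_{-1}=(1+w)u-3(1+w)u^3+2(1+2w)u^5,$$ $$\hat\tau_k=(1+kw)u^k-3(1+(k+2)w)u^{k+4}+2(1+(k+3)w)u^{k+6}\quad(k\ge0),$$ $$\tilde\tau_{-2}=\tfrac12\tau_{-1}u,\qquad \tilde\tau_{-1}=\tfrac12\left[(2w-1)u+(1+2w)u^5\right],$$ $$\tilde\tau_k=\tfrac12\left[2(1+kw)u^k-3(1+(k+1)w)u^{k+2}+(1+(k+3)w)u^{k+6}\right]\quad(k\ge0),$$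 $$a=1-2u^2+u^4-2u^2w+2u^4w,\qquad b=2u^2-u^4+w-u^4w-1,$$ $$\tilde a=1-u^2-2u^2w-u^2w^2,\qquad \tilde b=u^2+w+u^2w-1,$$ $$\Delta=(a-2\tau_{-1}u)^2-4\tau_{-1}u(b+\tau_{-1}u),$$ $$\alpha_1=\frac{-(a-2\tau_{-1}u)-\sqrt{\Delta}}{2(b+\tau_{-1}u)},\qquad \alpha_2=\frac{-(a-2\tau_{-1}u)+\sqrt{\Delta}}{2(b+\tau_{-1}u)},$$ and, for $l=1,2$, $p_l=-(b+\tau_{-1}u)\alpha_l$, $e_l=\tilde a\alpha_l+u^2\tilde b$, $d_l=(b+\tau_{-1}u)\alpha_l-\tau_{-1}u$. With $q=(1-u^2)^2$ and $r=2-3u^2+u^6$, define for $l=1,2$ $$C_{1,l}=\frac{\hat\tau_{-2}\tilde\tau_0[w(2-6u^2+4u^4)+q]}{\tau_{-1}u^2d_l}+\frac{w\hat\tau_{-2}\tilde\tau_0q}{u\,d_l^2}+\frac{\hat\tau_0\tilde\tau_0-\hat\tau_1\tilde\tau_{-1}}{\tau_{-1}u^4}-\frac{\hat\tau_{-2}\tilde\tau_{-1}[w(3-8u^2+5u^4)+q]}{\tau_{-1}u\,d_l}-\frac{w\hat\tau_{-2}\tilde\tau_{-1}q}{d_l^2},$$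 $$C_{2,l}=\frac{w\hat\tau_{-2}r[w(2-6u^2+4u^4)+q]}{2\tau_{-1}u^2d_l}+\frac{w^2\hat\tau_{-2}rq}{2u\,d_l^2}+\frac{w\hat\tau_0r}{2\tau_{-1}u^4}-\frac{wq\hat\tau_{-2}\tilde\tau_{-1}}{\tau_{-1}u\,d_l}-\frac{w(1-3u^4+2u^6)\tilde\tau_{-1}}{\tau_{-1}u^3},$$ $$C_{3,l}=\hat\tau_{-1}+\frac{\hat\tau_{-2}u[w(1-4u^2+3u^4)+q]}{d_l}+\frac{w\tau_{-1}u^2\hat\tau_{-2}q}{d_l^2},$$ $$C_{4,l}=\frac{\hat\tau_{-1}\tilde\tau_0}{\tau_{-1}u^4}+\frac{\hat\tau_{-2}\tilde\tau_0[w(1-4u^2+3u^4)+q]}{\tau_{-1}u^3d_l}+\frac{w\hat\tau_{-2}\tilde\tau_0q}{u^2d_l^2}-\frac{\hat\tau_1\tilde\tau_{-2}}{\tau_{-1}u^4}-\frac{\hat\tau_{-2}\tilde\tau_{-2}[w(3-8u^2+5u^4)+q]}{\tau_{-1}u\,d_l}-\frac{w\hat\tau_{-2}\tilde\tau_{-2}q}{d_l^2},$$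 $$C_{5,l}=\frac{w\hat\tau_{-1}r}{2\tau_{-1}u^4}+\frac{w\hat\tau_{-2}r[w(1-4u^2+3u^4)+q]}{2\tau_{-1}u^3d_l}+\frac{w^2\hat\tau_{-2}rq}{2u^2d_l^2}-\frac{w\hat\tau_{-2}\tilde\tau_{-2}q}{\tau_{-1}u\,d_l}-\frac{w(1-3u^4+2u^6)\tilde\tau_{-2}}{\tau_{-1}u^3},$$ $$C_{6,l}=\hat\tau_{-1}\tilde\tau_{-1}-\hat\tau_0\tilde\tau_{-2}+\frac{\hat\tau_{-2}u\tilde\tau_{-1}[w(1-4u^2+3u^4)+q]}{d_l}-\frac{\hat\tau_{-2}\tilde\tau_{-2}u^2[w(2-6u^2+4u^4)+q]}{d_l}+\frac{w\tau_{-1}u^2\hat\tau_{-2}(\tilde\tau_{-1}-u\tilde\tau_{-2})q}{d_l^2},$$ $$C_{7,l}=\frac{\hat\tau_{-2}u^2[w(2-6u^2+4u^4)+q]}{d_l}+\frac{w\tau_{-1}\hat\tau_{-2}u^3q}{d_l^2}+\hat\tau_0.$$ **Theorem 4.** If $n\ge4$, then $\Delta>0$, $\alpha_1\ne\alpha_2$,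 and $b+\tau_{-1}u$, $\tau_{-1}$, $u$, $d_1$, $d_2$ are nonzero, so that all expressions here are well defined. Moreover: (i) For $3\le i\le n-1$: $|R_{\theta,n;-i,-i;m}|=|R_{\theta,n;m}|$ for all $1\le m\le i-1$; $$|R_{\theta,n;-i,-i;i}|=\frac{C_{7,1}e_1}{\alpha_1-\alpha_2}p_1^{i-3}-\frac{C_{7,2}e_2}{\alpha_1-\alpha_2}p_2^{i-3};$$ and, for $i+1\le m\le n-1$, $$\begin{aligned}|R_{\theta,n;-i,-i;m}|={}&\frac{C_{1,1}\tau_{-1}u^4e_1}{(\alpha_1-\alpha_2)^2}\{(\alpha_1-u^2)p_1^{m-4}-(\alpha_2-u^2)p_1^{i-3}p_2^{m-i-1}\}\\&-\frac{C_{1,2}\tau_{-1}u^4e_2}{(\alpha_1-\alpha_2)^2}\{(\alpha_1-u^2)p_1^{m-i-1}p_2^{i-3}-(\alpha_2-u^2)p_2^{m-4}\}\\&+\frac{C_{2,1}\tau_{-1}u^6e_1}{(\alpha_1-\alpha_2)^2}\{p_1^{m-4}-p_1^{i-3}p_2^{m-i-1}\}-\frac{C_{2,2}\tau_{-1}u^6e_2}{(\alpha_1-\alpha_2)^2}\{p_1^{m-i-1}p_2^{i-3}-p_2^{m-4}\}.\end{aligned}$$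 (ii) For $3\le i\le n-1$: $|R_{\theta,n;-i,-(i+1);m}|=|R_{\theta,n;m}|$ for all $1\le m\le i-1$; $$|R_{\theta,n;-i,-(i+1);i}|=\frac{C_{3,1}e_1}{\alpha_1-\alpha_2}p_1^{i-3}-\frac{C_{3,2}e_2}{\alpha_1-\alpha_2}p_2^{i-3};$$ and, for $i+1\le m\le n-1$, $|R_{\theta,n;-i,-(i+1);m}|$ is given by the last formula of (i) with $C_{1,l}$, $C_{2,l}$ replaced by $C_{4,l}$, $C_{5,l}$. (iii) For $3\le i\le n-2$, $$|R_{\theta,n;-i,-n}|=\frac{C_{6,1}\tau_{-1}^{n-i-2}e_1}{\alpha_1-\alpha_2}p_1^{i-3}-\frac{C_{6,2}\tau_{-1}^{n-i-2}e_2}{\alpha_1-\alpha_2}p_2^{i-3}.$$ (iv) For $3\le i$ and $i+2\le j\le n-1$, $$\begin{aligned}|R_{\theta,n;-i,-j}|={}&\frac{C_{6,1}\tau_{-1}^{j-i-2}e_1}{(\alpha_1-\alpha_2)^2}\{(a\alpha_1+u^2b)p_1^{n-j+i-4}-(a\alpha_2+u^2b)p_1^{i-3}p_2^{n-j-1}\}\\&-\frac{C_{6,2}\tau_{-1}^{j-i-2}e_2}{(\alpha_1-\alpha_2)^2}\{(a\alpha_1+u^2b)p_1^{n-j-1}p_2^{i-3}-(a\alpha_2+u^2b)p_2^{n-j+i-4}\}.\end{aligned}$$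 -/

import Mathlib

namespace CovMatrix

/-- The `m × m` matrix with entries `(1 + |i - j| w) u ^ |i - j|`, where `w = θ / n` and
`u = exp (-w)`.  For `m = n` this is the correlation matrix of size `n`. -/
noncomputable def R (θ : ℝ) (n m : ℕ) : Matrix (Fin m) (Fin m) ℝ :=
  Matrix.of fun i j =>
    (1 + (((i : ℤ) - (j : ℤ)).natAbs : ℝ) * (θ / n)) *
      Real.exp (-(θ / n)) ^ ((i : ℤ) - (j : ℤ)).natAbs

/-- The increasing map of `m` positions into `m + 1` positions that omits the `i`-th one
(counting from 1).  If `i > m + 1`, nothing before the last position is omitted. -/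
def skip (i : ℕ) {m : ℕ} (k : Fin m) : Fin (m + 1) :=
  if (k : ℕ) + 1 < i then k.castSucc else k.succ

/-- The leading `m × m` block of the matrix obtained from `R θ n n` by deleting row `i` and column
`j` (both counted from 1).  Its entries lie in the first `m + 1` rows and columns of `R θ n n`.
For `m = n - 1` it is the whole matrix with row `i` and column `j` deleted. -/
noncomputable def RDel (θ : ℝ) (n i j m : ℕ) : Matrix (Fin m) (Fin m) ℝ :=
  (R θ n (m + 1)).submatrix (skip i) (skip j)

theorem skip_eq_succAbove {m : ℕ} (i : Fin (m + 1)) :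
    (skip (i + 1) : Fin m → Fin (m + 1)) = i.succAbove := by
  funext k
  simp only [skip, Fin.succAbove, Fin.lt_def, Fin.val_castSucc, Nat.add_lt_add_iff_right]

/-- The whole matrix: deletion of one row and one column in the usual sense. -/
theorem RDel_full (θ : ℝ) (N : ℕ) (i j : Fin (N + 1)) :
    RDel θ (N + 1) (i + 1) (j + 1) N =
      (R θ (N + 1) (N + 1)).submatrix i.succAbove j.succAbove := by
  rw [RDel, skip_eq_succAbove, skip_eq_succAbove]

/-- The blocks: `RDel θ n i j m` is the leading block of `RDel θ n i j M` for `m ≤ M`. -/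
theorem RDel_leading (θ : ℝ) (n i j : ℕ) {m M : ℕ} (h : m ≤ M) :
    RDel θ n i j m =
      (RDel θ n i j M).submatrix (Fin.castLE h) (Fin.castLE h) := by
  have key : ∀ (i : ℕ) (k : Fin m),
      ((skip i k : Fin (m + 1)) : ℕ) = (skip i (Fin.castLE h k) : Fin (M + 1)) := by
    intro i k
    simp only [skip, Fin.val_castLE]
    split_ifs <;> simp
  ext k l
  simp only [RDel, R, Matrix.submatrix_apply, Matrix.of_apply, key]

/-- `τ_k`, for integers `k ≥ -2`. -/
noncomputable def tau (w u : ℝ) (k : ℤ) : ℝ :=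
  if k = -2 then 0
  else if k = -1 then (w - 1) * u + (1 + w) * u ^ 3
  else (1 + k * w) * u ^ k - 2 * (1 + (k + 1) * w) * u ^ (k + 2)
    + (1 + (k + 2) * w) * u ^ (k + 4)

/-- `τ̂_k`, for integers `k ≥ -2`. -/
noncomputable def tauHat (w u : ℝ) (k : ℤ) : ℝ :=
  if k = -2 then 2 * tau w u (-1) * u
  else if k = -1 then (1 + w) * u - 3 * (1 + w) * u ^ 3 + 2 * (1 + 2 * w) * u ^ 5
  else (1 + k * w) * u ^ k - 3 * (1 + (k + 2) * w) * u ^ (k + 4)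
    + 2 * (1 + (k + 3) * w) * u ^ (k + 6)

/-- `τ̃_k`, for integers `k ≥ -2`. -/
noncomputable def tauTilde (w u : ℝ) (k : ℤ) : ℝ :=
  if k = -2 then tau w u (-1) * u / 2
  else if k = -1 then ((2 * w - 1) * u + (1 + 2 * w) * u ^ 5) / 2
  else (2 * (1 + k * w) * u ^ k - 3 * (1 + (k + 1) * w) * u ^ (k + 2)
    + (1 + (k + 3) * w) * u ^ (k + 6)) / 2

noncomputable def coefA (w u : ℝ) : ℝ :=
  1 - 2 * u ^ 2 + u ^ 4 - 2 * u ^ 2 * w + 2 * u ^ 4 * w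

noncomputable def coefB (w u : ℝ) : ℝ :=
  2 * u ^ 2 - u ^ 4 + w - u ^ 4 * w - 1

noncomputable def coefATilde (w u : ℝ) : ℝ :=
  1 - u ^ 2 - 2 * u ^ 2 * w - u ^ 2 * w ^ 2

noncomputable def coefBTilde (w u : ℝ) : ℝ :=
  u ^ 2 + w + u ^ 2 * w - 1

/-- The discriminant of the quadratic `τ_{-1} u + (a - 2 τ_{-1} u) z + (b + τ_{-1} u) z ^ 2`. -/
noncomputable def discr (w u : ℝ) : ℝ :=
  (coefA w u - 2 * tau w u (-1) * u) ^ 2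
    - 4 * tau w u (-1) * u * (coefB w u + tau w u (-1) * u)

noncomputable def alpha1 (w u : ℝ) : ℝ :=
  (-(coefA w u - 2 * tau w u (-1) * u) - √(discr w u)) /
    (2 * (coefB w u + tau w u (-1) * u))

noncomputable def alpha2 (w u : ℝ) : ℝ :=
  (-(coefA w u - 2 * tau w u (-1) * u) + √(discr w u)) /
    (2 * (coefB w u + tau w u (-1) * u))

/-- The recurring denominator `(b + τ_{-1} u) α - τ_{-1} u`. -/
noncomputable def den (w u α : ℝ) : ℝ :=
  (coefB w u + tau w u (-1) * u) * α - tau w u (-1) * u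

/-! The constants `C_{k,i}` for `k = 1, …, 7` and `i = 1, 2`: `C_{k,i}` is `Ck w u α_i`. -/

noncomputable def C1 (w u α : ℝ) : ℝ :=
  tauHat w u (-2) * tauTilde w u 0 *
      (w * (2 - 6 * u ^ 2 + 4 * u ^ 4) + (1 - u ^ 2) ^ 2) /
      (tau w u (-1) * u ^ 2 * den w u α)
    + w * tauHat w u (-2) * tauTilde w u 0 * (1 - u ^ 2) ^ 2 / (u * den w u α ^ 2)
    + (tauHat w u 0 * tauTilde w u 0 - tauHat w u 1 * tauTilde w u (-1)) /
      (tau w u (-1) * u ^ 4)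
    - tauHat w u (-2) * tauTilde w u (-1) *
      (w * (3 - 8 * u ^ 2 + 5 * u ^ 4) + (1 - u ^ 2) ^ 2) /
      (tau w u (-1) * u * den w u α)
    - w * tauHat w u (-2) * tauTilde w u (-1) * (1 - u ^ 2) ^ 2 / den w u α ^ 2

noncomputable def C2 (w u α : ℝ) : ℝ :=
  w * tauHat w u (-2) * (2 - 3 * u ^ 2 + u ^ 6) *
      (w * (2 - 6 * u ^ 2 + 4 * u ^ 4) + (1 - u ^ 2) ^ 2) /
      (2 * tau w u (-1) * u ^ 2 * den w u α)
    + w ^ 2 * tauHat w u (-2) * (2 - 3 * u ^ 2 + u ^ 6) * (1 - u ^ 2) ^ 2 /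
      (2 * u * den w u α ^ 2)
    + w * tauHat w u 0 * (2 - 3 * u ^ 2 + u ^ 6) / (2 * tau w u (-1) * u ^ 4)
    - w * (1 - u ^ 2) ^ 2 * tauHat w u (-2) * tauTilde w u (-1) /
      (tau w u (-1) * u * den w u α)
    - w * (1 - 3 * u ^ 4 + 2 * u ^ 6) * tauTilde w u (-1) / (tau w u (-1) * u ^ 3)

noncomputable def C3 (w u α : ℝ) : ℝ :=
  tauHat w u (-1)
    + tauHat w u (-2) * u * (w * (1 - 4 * u ^ 2 + 3 * u ^ 4) + (1 - u ^ 2) ^ 2) / den w u α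
    + w * tau w u (-1) * u ^ 2 * tauHat w u (-2) * (1 - u ^ 2) ^ 2 / den w u α ^ 2

noncomputable def C4 (w u α : ℝ) : ℝ :=
  tauHat w u (-1) * tauTilde w u 0 / (tau w u (-1) * u ^ 4)
    + tauHat w u (-2) * tauTilde w u 0 *
      (w * (1 - 4 * u ^ 2 + 3 * u ^ 4) + (1 - u ^ 2) ^ 2) /
      (tau w u (-1) * u ^ 3 * den w u α)
    + w * tau w u (-1) * tauHat w u (-2) * tauTilde w u 0 * (1 - u ^ 2) ^ 2 /
      (tau w u (-1) * u ^ 2 * den w u α ^ 2)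
    - tauHat w u 1 * tauTilde w u (-2) / (tau w u (-1) * u ^ 4)
    - tauHat w u (-2) * tauTilde w u (-2) *
      (w * (3 - 8 * u ^ 2 + 5 * u ^ 4) + (1 - u ^ 2) ^ 2) /
      (tau w u (-1) * u * den w u α)
    - w * tauHat w u (-2) * tauTilde w u (-2) * (1 - u ^ 2) ^ 2 / den w u α ^ 2

noncomputable def C5 (w u α : ℝ) : ℝ :=
  w * tauHat w u (-1) * (2 - 3 * u ^ 2 + u ^ 6) / (2 * tau w u (-1) * u ^ 4)
    + w * tauHat w u (-2) * (2 - 3 * u ^ 2 + u ^ 6) *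
      (w * (1 - 4 * u ^ 2 + 3 * u ^ 4) + (1 - u ^ 2) ^ 2) /
      (2 * tau w u (-1) * u ^ 3 * den w u α)
    + w ^ 2 * tauHat w u (-2) * (2 - 3 * u ^ 2 + u ^ 6) * (1 - u ^ 2) ^ 2 /
      (2 * u ^ 2 * den w u α ^ 2)
    - w * tauHat w u (-2) * tauTilde w u (-2) * (1 - u ^ 2) ^ 2 /
      (tau w u (-1) * u * den w u α)
    - w * (1 - 3 * u ^ 4 + 2 * u ^ 6) * tauTilde w u (-2) / (tau w u (-1) * u ^ 3)

noncomputable def C6 (w u α : ℝ) : ℝ :=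
  tauHat w u (-1) * tauTilde w u (-1) - tauHat w u 0 * tauTilde w u (-2)
    + tauHat w u (-2) * u * tauTilde w u (-1) *
      (w * (1 - 4 * u ^ 2 + 3 * u ^ 4) + (1 - u ^ 2) ^ 2) / den w u α
    - tauHat w u (-2) * tauTilde w u (-2) * u ^ 2 *
      (w * (2 - 6 * u ^ 2 + 4 * u ^ 4) + (1 - u ^ 2) ^ 2) / den w u α
    + w * tau w u (-1) * u ^ 2 * tauHat w u (-2) *
      (tauTilde w u (-1) - u * tauTilde w u (-2)) * (1 - u ^ 2) ^ 2 / den w u α ^ 2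

noncomputable def C7 (w u α : ℝ) : ℝ :=
  tauHat w u (-2) * u ^ 2 * (w * (2 - 6 * u ^ 2 + 4 * u ^ 4) + (1 - u ^ 2) ^ 2) / den w u α
    + w * tau w u (-1) * tauHat w u (-2) * u ^ 3 * (1 - u ^ 2) ^ 2 / den w u α ^ 2
    + tauHat w u 0

end CovMatrix

open CovMatrix

/-! The kernel `(1 + r w) u ^ r` is a solution of the difference equation with double characteristic
root `u`. Apply `(1 - u S) ^ 2`, with `S` the backward shift, to rows and columns of the correlation
matrix, leaving the first two positions alone. This kills every entry at distance two or more from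
the diagonal, so `F R Fᵀ = T` with `F` unitriangular and `T` symmetric tridiagonal: diagonal `1, 1,
d, d, …`, off-diagonal `c, t, t, …`, where `t` is `τ_{-1}`. (In probabilistic terms, the filtered
process is a moving average of order one.)

Hence `R⁻¹ = Fᵀ T⁻¹ F`, and `T⁻¹` is a Green's kernel `g (min k l) * h (max k l)` divided by a
Wronskian, with `g` solving the system from the left end and `h` from the right. The Wronskian is
`lead c t d N`, which is also `det R`; it cancels, and each minor is, up to sign, the transposed
filter applied in both variables to `g (min k l) * h (max k l)` (`det_corrMat_submatrix`). When the
two positions are at least two apart this is a product of a filtered `g` and a filtered `h`; for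
adjacent or equal positions a multiple of the Wronskian is added (`cofac_far`, `cofac_adjacent`,
`cofac_diag`).

The recurrence of `T` has characteristic equation `t (y ^ 2 + 1) = d y`, with roots `x` and `z = 1 /
x`, positive and distinct because `0 < 2 t < d`. These satisfy `α₁ = -u x`, `α₂ = -u z`, `p₁ = t x`,
`p₂ = t z`, and both solutions become combinations of powers of `x` and `z`. It remains to reduce
the constants `C_{k,l}` modulo the equation of the roots and to compare coefficients. Division by
leading minors is legitimate because they are all positive (`lead_pos`). -/

namespace CovMatrix

open Finset Matrix

/-! ### Green's function of a symmetric tridiagonal matrix -/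

/-- Entries of the symmetric tridiagonal matrix with diagonal `A` and off-diagonal `B`. -/
def tridiag (A B : ℕ → ℝ) (k l : ℕ) : ℝ :=
  (if l = k then A k else 0) + (if l = k + 1 then B k else 0) + (if k = l + 1 then B l else 0)

/-- The kernel `g (min k l) * h (max k l)`. -/
def green (g h : ℕ → ℝ) (k l : ℕ) : ℝ := g (min k l) * h (max k l)

theorem green_of_le (g h : ℕ → ℝ) {k l : ℕ} (hkl : k ≤ l) : green g h k l = g k * h l := by
  rw [green, min_eq_left hkl, max_eq_right hkl]

theorem green_of_ge (g h : ℕ → ℝ) {k l : ℕ} (hkl : l ≤ k) : green g h k l = g l * h k := by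
  rw [green, min_eq_right hkl, max_eq_left hkl]

/-- The boundary condition `v N = 0` makes the formula valid even when the right neighbour falls
outside the range, so the last row needs no separate treatment, here and in the next lemma. -/
theorem sum_tridiag_zero (A B v : ℕ → ℝ) {N : ℕ} (hN : 0 < N) (hv : v N = 0) :
    ∑ s ∈ range N, tridiag A B 0 s * v s = A 0 * v 0 + B 0 * v 1 := by
  have h1 : 1 < N ∨ v 1 = 0 := by
    rcases Nat.lt_or_ge 1 N with h | h
    · exact Or.inl h
    · right
      have : N = 1 := by omega
      rwa [this] at hv
  simp only [tridiag, add_mul, sum_add_distrib, ite_mul, zero_mul, sum_ite_eq', mem_range]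
  rcases h1 with h1 | h1 <;> simp [hN, h1]

theorem sum_tridiag_succ (A B v : ℕ → ℝ) {N k : ℕ} (hk : k + 1 < N) (hv : v N = 0) :
    ∑ s ∈ range N, tridiag A B (k + 1) s * v s =
      B k * v k + A (k + 1) * v (k + 1) + B (k + 1) * v (k + 2) := by
  have h1 : k + 2 < N ∨ v (k + 2) = 0 := by
    rcases Nat.lt_or_ge (k + 2) N with h | h
    · exact Or.inl h
    · right
      have : N = k + 2 := by omega
      rwa [this] at hv
  have e : ∀ s, (k + 1 = s + 1) = (s = k) := fun s => by simp [eq_comm]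
  simp only [tridiag, add_mul, sum_add_distrib, ite_mul, zero_mul, sum_ite_eq', mem_range, e]
  have hk' : k < N := by omega
  rcases h1 with h1 | h1 <;> simp [hk, hk', h1, add_assoc] <;> ring

/-- Off the diagonal a row of the operator meets only the factor `g` or only the factor `h`, and
that factor solves the homogeneous equation. On the diagonal, the equation for `g` leaves exactly
the Wronskian. -/
theorem sum_tridiag_mul_green {A B g h : ℕ → ℝ} {N : ℕ} {W : ℝ}
    (hg0 : A 0 * g 0 + B 0 * g 1 = 0)
    (hg : ∀ k, B k * g k + A (k + 1) * g (k + 1) + B (k + 1) * g (k + 2) = 0)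
    (hh : ∀ k, k + 1 < N → B k * h k + A (k + 1) * h (k + 1) + B (k + 1) * h (k + 2) = 0)
    (hN : h N = 0) (hW : ∀ k, k < N → B k * (g k * h (k + 1) - g (k + 1) * h k) = W)
    {k l : ℕ} (hk : k < N) (hl : l < N) :
    ∑ s ∈ range N, tridiag A B k s * green g h s l = if k = l then W else 0 := by
  have hv : green g h N l = 0 := by rw [green_of_ge g h hl.le, hN, mul_zero]
  have hWl := hW l hl
  rcases k with _ | k
  · rw [sum_tridiag_zero A B (fun s => green g h s l) hk hv]
    rcases Nat.eq_zero_or_pos l with rfl | hl0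
    · rw [green_of_le g h le_rfl, green_of_ge g h (Nat.zero_le 1), if_pos rfl]
      linear_combination h 0 * hg0 + hWl
    · rw [green_of_le g h (Nat.zero_le l), green_of_le g h hl0, if_neg hl0.ne]
      linear_combination h l * hg0
  · rw [sum_tridiag_succ A B (fun s => green g h s l) hk hv]
    rcases lt_trichotomy (k + 1) l with hkl | hkl | hkl
    · rw [green_of_le g h (by omega), green_of_le g h hkl.le, green_of_le g h hkl,
        if_neg hkl.ne]
      linear_combination h l * hg k
    · subst hkl
      rw [green_of_le g h (by omega), green_of_le g h le_rfl, green_of_ge g h (by omega),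
        if_pos rfl]
      linear_combination h (k + 1) * hg k + hWl
    · rw [green_of_ge g h (by omega), green_of_ge g h hkl.le, green_of_ge g h (by omega),
        if_neg hkl.ne']
      linear_combination g l * hh k hk

/-! ### The second-order filter and the filtered correlation matrix -/

/-- The correlation between positions `k` and `l`. -/
noncomputable def corr (w u : ℝ) (k l : ℕ) : ℝ :=
  (1 + (((k : ℤ) - (l : ℤ)).natAbs : ℝ) * w) * u ^ ((k : ℤ) - (l : ℤ)).natAbs

theorem corr_comm (w u : ℝ) (k l : ℕ) : corr w u k l = corr w u l k := by
  rw [corr, corr, ← Int.natAbs_neg, neg_sub]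

theorem corr_add (w u : ℝ) (k r : ℕ) : corr w u k (k + r) = (1 + r * w) * u ^ r := by
  have : ((k : ℤ) - ((k + r : ℕ) : ℤ)).natAbs = r := by omega
  rw [corr, this]

/-- The difference operator annihilating `(1 + k w) u ^ k`, trivial in the first two positions. -/
def filt (u : ℝ) (v : ℕ → ℝ) (k : ℕ) : ℝ :=
  if k < 2 then v k else v k - 2 * u * v (k - 1) + u ^ 2 * v (k - 2)

/-- The transpose of `filt` away from the first position. -/
def filtT (u : ℝ) (v : ℕ → ℝ) (k : ℕ) : ℝ := v k - 2 * u * v (k + 1) + u ^ 2 * v (k + 2)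

/-- The matrix of `filt`. -/
noncomputable def filtMat (u : ℝ) (N : ℕ) : Matrix (Fin N) (Fin N) ℝ :=
  of fun k s => filt u (fun r => if r = s then 1 else 0) k

theorem det_filtMat (u : ℝ) (N : ℕ) : (filtMat u N).det = 1 := by
  rw [det_of_isLowerTriangular]
  · refine prod_eq_one fun k _ => ?_
    simp only [filtMat, of_apply, filt]
    split_ifs <;> first | omega | simp
  · intro k s hks
    have hks' : (k : ℕ) < s := hks
    simp only [filtMat, of_apply, filt]
    split_ifs <;> first | omega | simp

theorem sum_filtMat_mul (u : ℝ) {N : ℕ} (v : ℕ → ℝ) (k : Fin N) :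
    ∑ s : Fin N, filtMat u N k s * v s = filt u v k := by
  have hk := k.2
  simp only [filtMat, of_apply]
  rw [Fin.sum_univ_eq_sum_range
    (fun s => filt u (fun r => if r = s then 1 else 0) k * v s) N]
  unfold filt
  split_ifs with h
  · simp
  · simp only [add_mul, sub_mul, mul_assoc, sum_add_distrib, sum_sub_distrib, ← mul_sum, ite_mul,
      one_mul, zero_mul, sum_ite_eq, mem_range]
    rw [if_pos hk, if_pos (by omega), if_pos (by omega)]

/-- Column `j` of the filter carries `1`, `-2 u`, `u ^ 2` in rows `j`, `j + 1`, `j + 2`. The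
vanishing of `v` from `N` on lets columns cut off by the end of the matrix obey the same formula. -/
theorem sum_mul_filtMat (u : ℝ) {N : ℕ} (v : ℕ → ℝ) (hv : ∀ k, N ≤ k → v k = 0) (j : Fin N)
    (hj : 2 ≤ (j : ℕ)) : ∑ s : Fin N, v s * filtMat u N s j = filtT u v j := by
  have hjN := j.2
  simp only [filtMat, of_apply]
  rw [Fin.sum_univ_eq_sum_range
    (fun s => v s * filt u (fun r => if r = j then 1 else 0) s) N]
  have e : ∀ s, v s * filt u (fun r => if r = j then 1 else 0) s =
      (if s = (j : ℕ) then v s else 0) - 2 * u * (if s = (j : ℕ) + 1 then v s else 0)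
        + u ^ 2 * (if s = (j : ℕ) + 2 then v s else 0) := by
    intro s
    simp only [filt]
    split_ifs <;> first | omega | ring
  simp only [e, sum_add_distrib, sum_sub_distrib, ← mul_sum, sum_ite_eq', mem_range, if_pos hjN,
    filtT]
  congr 2
  · congr 1
    split_ifs with h
    · rfl
    · rw [hv _ (by omega)]
  · split_ifs with h
    · rfl
    · rw [hv _ (by omega)]

/-- The diagonal of the filtered correlation matrix. -/
def diagT (d : ℝ) : ℕ → ℝ
  | 0 => 1
  | 1 => 1
  | _ + 2 => d

/-- The off-diagonal of the filtered correlation matrix. -/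
def offT (c t : ℝ) : ℕ → ℝ
  | 0 => c
  | _ + 1 => t

/-- If `l ≥ k + 2`, the window `l - 2, l - 1, l` of the inner filter stays on one side of every row
index used by the outer one, where the kernel solves the difference equation, so the result is zero.
Only the cusp at the diagonal contributes, which gives `d` and `t`; the unfiltered corner gives `1,
1, c`. -/
theorem corr_filt_filt_le {w u c t d : ℝ} (hc : c = (1 + w) * u)
    (ht : t = (w - 1) * u + (1 + w) * u ^ 3) (hd : d = 1 - u ^ 4 - 4 * u ^ 2 * w) {k l : ℕ}
    (hkl : k ≤ l) :
    filt u (fun r => filt u (fun s => corr w u r s) l) k = tridiag (diagT d) (offT c t) k l := by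
  have key : ∀ k r, corr w u k (k + r) = (1 + r * w) * u ^ r := corr_add w u
  have key' : ∀ k r, corr w u (k + r) k = (1 + r * w) * u ^ r := fun k r => by
    rw [corr_comm, key]
  have k0 : ∀ k, corr w u k k = 1 := fun k => by simpa using key k 0
  obtain ⟨r, rfl⟩ := Nat.exists_eq_add_of_le hkl
  rcases k with _ | _ | k
  · rcases r with _ | _ | r
    · simp [filt, tridiag, diagT, k0]
    · have := key 0 1
      simp only [Nat.zero_add] at this
      simp [filt, tridiag, offT, this, hc]
    · have e0 := key 0 r
      have e1 := key 0 (r + 1)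
      have e2 := key 0 (r + 2)
      simp only [Nat.zero_add] at e0 e1 e2
      simp [filt, tridiag, e0, e1, e2]
      ring
  · rcases r with _ | _ | r
    · simp [filt, tridiag, diagT, k0]
    · have e0 := key 1 1
      have e1 := key' 0 1
      simp only [Nat.zero_add, Nat.reduceAdd] at e0 e1
      simp [filt, tridiag, offT, e0, e1, k0, ht]
      ring
    · have e0 := key 1 r
      have e1 := key 1 (r + 1)
      have e2 := key 1 (r + 2)
      have a0 : 0 + 1 + (r + 1 + 1) = 1 + (r + 2) := by omega
      have a1 : 1 + (r + 2) - 1 = 1 + (r + 1) := by omega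
      have a2 : 1 + (r + 2) - 2 = 1 + r := by omega
      have a3 : ¬ (1 + (r + 2) < 2) := by omega
      simp only [filt, a0, a1, a2, a3, if_false, tridiag, e0, e1, e2, Nat.zero_add]
      rw [if_pos (by omega), if_neg (by omega), if_neg (by omega), if_neg (by omega)]
      push_cast
      ring
  · have e0 := key (k + 2) r
    have f0 := key (k + 1) r
    have g0 := key k r
    have f1 := key (k + 1) (r + 1)
    have g1 := key k (r + 1)
    have g2 := key k (r + 2)
    have a0 : k + 1 + 1 + r = k + 2 + r := rfl
    have b0 : k + 2 + r - 1 = k + 1 + r := by omega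
    have b1 : k + 2 + r - 2 = k + r := by omega
    have b2 : ¬ (k + 2 + r < 2) := by omega
    have c0 : k + 2 - 1 = k + 1 := by omega
    have c1 : k + 2 - 2 = k := by omega
    have c2 : ¬ (k + 2 < 2) := by omega
    have f1' : corr w u (k + 1) (k + 2 + r) = (1 + (r + 1 : ℕ) * w) * u ^ (r + 1) := by
      rw [← f1]; congr 1; omega
    have g1' : corr w u k (k + 1 + r) = (1 + (r + 1 : ℕ) * w) * u ^ (r + 1) := by
      rw [← g1]; congr 1; omega
    have g2' : corr w u k (k + 2 + r) = (1 + (r + 2 : ℕ) * w) * u ^ (r + 2) := by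
      rw [← g2]; congr 1; omega
    simp only [filt, a0, b0, b1, b2, c0, c1, c2, if_false, e0, f0, g0, f1', g1', g2',
      Nat.add_assoc k 1 1, Nat.reduceAdd]
    rcases r with _ | _ | r
    · have h1 := key' (k + 1) 1
      have h2 := key' k 2
      have h3 := key' k 1
      simp only [Nat.add_assoc, Nat.reduceAdd] at h1 h2 h3
      simp only [Nat.add_zero, h1, h2, h3, tridiag, diagT, if_true, left_eq_add,
        one_ne_zero, if_false, hd]
      push_cast
      ring
    · have h1 := k0 (k + 2)
      have h3 := k0 (k + 1)
      have h4 := key' (k + 1) 1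
      simp only [Nat.add_assoc, Nat.reduceAdd] at h1 h3 h4
      simp only [Nat.zero_add, Nat.add_assoc, Nat.reduceAdd, h1, h3, h4, tridiag, offT,
        if_true, ht]
      rw [if_neg (by omega), if_neg (by omega)]
      push_cast
      ring
    · have h1 : corr w u (k + 2) (k + 1 + (r + 1 + 1)) = (1 + (r + 1 : ℕ) * w) * u ^ (r + 1) := by
        rw [← key (k + 2) (r + 1)]; congr 1; omega
      have h2 : corr w u (k + 2) (k + (r + 1 + 1)) = (1 + (r : ℕ) * w) * u ^ r := by
        rw [← key (k + 2) r]; congr 1; omega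
      have h3 : corr w u (k + 1) (k + (r + 1 + 1)) = (1 + (r + 1 : ℕ) * w) * u ^ (r + 1) := by
        rw [← key (k + 1) (r + 1)]; congr 1; omega
      rw [h1, h2, h3, tridiag, if_neg (by omega), if_neg (by omega), if_neg (by omega)]
      push_cast
      ring

/-! ### Cofactors of the correlation matrix -/

/-- The correlation matrix of size `N`. -/
noncomputable def corrMat (w u : ℝ) (N : ℕ) : Matrix (Fin N) (Fin N) ℝ :=
  of fun k l => corr w u k l

theorem corrMat_transpose (w u : ℝ) (N : ℕ) : (corrMat w u N)ᵀ = corrMat w u N := by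
  ext k l
  exact corr_comm w u l k

theorem filtMat_mul_corrMat_mul {w u c t d : ℝ} (hc : c = (1 + w) * u)
    (ht : t = (w - 1) * u + (1 + w) * u ^ 3) (hd : d = 1 - u ^ 4 - 4 * u ^ 2 * w) (N : ℕ) :
    filtMat u N * corrMat w u N * (filtMat u N)ᵀ =
      of fun k l : Fin N => tridiag (diagT d) (offT c t) k l := by
  set M := filtMat u N * corrMat w u N * (filtMat u N)ᵀ with hM
  have hsymm : ∀ k l, M k l = M l k := by
    intro k l
    have : Mᵀ = M := by
      rw [hM, transpose_mul, transpose_mul, transpose_transpose, corrMat_transpose, mul_assoc]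
    exact congrFun (congrFun this l) k
  have hle : ∀ k l : Fin N, (k : ℕ) ≤ l → M k l = tridiag (diagT d) (offT c t) k l := by
    intro k l hkl
    rw [← corr_filt_filt_le hc ht hd hkl, hM, mul_assoc, mul_apply,
      ← sum_filtMat_mul u (fun r => filt u (fun s => corr w u r s) l) k]
    refine sum_congr rfl fun r _ => ?_
    rw [mul_apply, ← sum_filtMat_mul u (fun s => corr w u r s) l]
    congr 1
    refine sum_congr rfl fun s _ => ?_
    rw [transpose_apply, mul_comm]
    rfl
  ext k l
  rcases le_total (k : ℕ) l with h | h
  · exact hle k l h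
  · rw [hsymm, hle l k h]
    simp only [of_apply, tridiag]
    by_cases e : (k : ℕ) = l
    · rw [e]
    · rw [if_neg e, if_neg (Ne.symm e)]
      ring

/-- The leading principal minors of the filtered correlation matrix. -/
noncomputable def lead (c t d : ℝ) : ℕ → ℝ
  | 0 => 1
  | 1 => 1
  | 2 => 1 - c ^ 2
  | k + 3 => d * lead c t d (k + 2) - t ^ 2 * lead c t d (k + 1)

/-- `trail t d k` is the determinant of the tridiagonal Toeplitz matrix of size `k - 1` with
entries `t`, `d`, `t`. -/
noncomputable def trail (t d : ℝ) : ℕ → ℝ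
  | 0 => 0
  | 1 => 1
  | k + 2 => d * trail t d (k + 1) - t ^ 2 * trail t d k

/-- The solution of the tridiagonal system satisfying the equation of the first row. -/
noncomputable def solL (c t d : ℝ) : ℕ → ℝ
  | 0 => c / t
  | k + 1 => lead c t d (k + 1) / (-t) ^ (k + 1)

/-- The solution of the tridiagonal system vanishing at `N`. -/
noncomputable def solR (c t d : ℝ) (N : ℕ) : ℕ → ℝ
  | 0 => -((-t) * trail t d (N - 1) + t * ((-t) ^ 2 * trail t d (N - 2))) / c
  | k + 1 => (-t) ^ (k + 1) * trail t d (N - (k + 1))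

/-- The left solution of a tridiagonal system is the sequence of leading minors over signed products
of off-diagonal entries. Scaling it by `c / t` removes `c` from every value but the one at position
0. -/
theorem solL_rec {c t d : ℝ} (ht : t ≠ 0) (k : ℕ) :
    offT c t k * solL c t d k + diagT d (k + 1) * solL c t d (k + 1)
      + offT c t (k + 1) * solL c t d (k + 2) = 0 := by
  obtain ⟨s, rfl⟩ : ∃ s, t = -s := ⟨-t, (neg_neg t).symm⟩
  have hs : s ≠ 0 := neg_ne_zero.1 ht
  rcases k with _ | k
  · simp only [offT, solL, diagT, lead, neg_neg]
    field_simp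
    ring
  · simp only [offT, solL, diagT, lead, neg_neg]
    field_simp
    ring

/-- Past the corner this is the recurrence of `trail`. The value at position 0 is the one that
solves the equation of row 1, whence the division by `c`. -/
theorem solR_rec {c t d : ℝ} (hc : c ≠ 0) {N k : ℕ} (hk : k + 1 < N) :
    offT c t k * solR c t d N k + diagT d (k + 1) * solR c t d N (k + 1)
      + offT c t (k + 1) * solR c t d N (k + 2) = 0 := by
  rcases k with _ | k
  · simp only [offT, solR, diagT, Nat.zero_add]
    field_simp
    ring
  · obtain ⟨r, rfl⟩ := Nat.exists_eq_add_of_lt hk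
    have e1 : k + 1 + 1 + r + 1 - (k + 1) = r + 2 := by omega
    have e2 : k + 1 + 1 + r + 1 - (k + 1 + 1) = r + 1 := by omega
    have e3 : k + 1 + 1 + r + 1 - (k + 2 + 1) = r := by omega
    simp only [offT, solR, diagT, e1, e2, e3, trail]
    ring

theorem solR_of_le {c t d : ℝ} {N k : ℕ} (hN : 0 < N) (hk : N ≤ k) : solR c t d N k = 0 := by
  obtain ⟨k, rfl⟩ := Nat.exists_eq_succ_of_ne_zero (by omega : k ≠ 0)
  have : N - (k + 1) = 0 := by omega
  simp [solR, this, trail]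

/-- The weighted Wronskian is the same in all rows. In the last row the right solution vanishes at
`N`, and the remaining term is `lead c t d N`. The induction is on the distance to that row. -/
theorem solL_solR_wronskian {c t d : ℝ} (hc : c ≠ 0) (ht : t ≠ 0) {N : ℕ} (hN : 2 ≤ N) {k : ℕ}
    (hk : k < N) :
    offT c t k * (solL c t d k * solR c t d N (k + 1) - solL c t d (k + 1) * solR c t d N k) =
      lead c t d N := by
  have step : ∀ k, k + 1 < N →
      offT c t k * (solL c t d k * solR c t d N (k + 1) - solL c t d (k + 1) * solR c t d N k) =
      offT c t (k + 1) * (solL c t d (k + 1) * solR c t d N (k + 2)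
        - solL c t d (k + 2) * solR c t d N (k + 1)) := by
    intro k hk
    linear_combination solR c t d N (k + 1) * solL_rec (c := c) (d := d) ht k
      - solL c t d (k + 1) * solR_rec (t := t) (d := d) hc hk
  obtain ⟨r, hr⟩ := Nat.exists_eq_add_of_lt hk
  induction r generalizing k with
  | zero =>
    obtain ⟨k, rfl⟩ := Nat.exists_eq_succ_of_ne_zero (by omega : k ≠ 0)
    rw [solR_of_le (by omega) (by omega : N ≤ k.succ + 1)]
    subst hr
    have e : k + 1 + 0 + 1 - (k + 1) = 1 := by omega
    simp only [offT, solL, solR, Nat.succ_eq_add_one, e, trail, Nat.add_zero]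
    have hs := pow_ne_zero (k + 1) (neg_ne_zero.2 ht)
    rw [pow_succ (-t) (k + 1)]
    generalize (-t) ^ (k + 1) = s at hs ⊢
    field_simp
    ring
  | succ r ih =>
    rw [step k (by omega)]
    exact ih (by omega) (by omega)

/-- The inverse of the correlation matrix, multiplied by the determinant, at positions past the
second. -/
noncomputable def cofac (u c t d : ℝ) (N i j : ℕ) : ℝ :=
  filtT u (fun k => filtT u (fun l => green (solL c t d) (solR c t d N) k l) j) i

theorem corrMat_mul_conj_green {w u c t d : ℝ} (hc : c = (1 + w) * u)
    (ht : t = (w - 1) * u + (1 + w) * u ^ 3) (hd : d = 1 - u ^ 4 - 4 * u ^ 2 * w)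
    (hc0 : c ≠ 0) (ht0 : t ≠ 0) {N : ℕ} (hN : 2 ≤ N) :
    corrMat w u N * ((filtMat u N)ᵀ *
      (of fun k l : Fin N => green (solL c t d) (solR c t d N) k l) * filtMat u N) =
      lead c t d N • (1 : Matrix (Fin N) (Fin N) ℝ) := by
  set X : Matrix (Fin N) (Fin N) ℝ := of fun k l => green (solL c t d) (solR c t d N) k l with hX
  have hTX : filtMat u N * corrMat w u N * (filtMat u N)ᵀ * X =
      lead c t d N • (1 : Matrix (Fin N) (Fin N) ℝ) := by
    rw [filtMat_mul_corrMat_mul hc ht hd]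
    ext k l
    rw [mul_apply]
    simp only [of_apply, hX, Matrix.smul_apply, one_apply, smul_eq_mul, mul_ite, mul_one, mul_zero]
    rw [Fin.sum_univ_eq_sum_range (fun s => tridiag (diagT d) (offT c t) k s *
      green (solL c t d) (solR c t d N) s l) N,
      sum_tridiag_mul_green (W := lead c t d N) _ (solL_rec ht0) (fun k hk => solR_rec hc0 hk)
        (solR_of_le (by omega) le_rfl) (fun k hk => solL_solR_wronskian hc0 ht0 hN hk) k.2 l.2]
    · simp only [Fin.ext_iff]
    · simp only [diagT, offT, solL, lead]
      rw [zero_add, pow_one, div_neg, one_mul, mul_neg, mul_one_div, add_neg_cancel]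
  -- The filter has determinant 1, so its adjugate is its inverse, and the identity can be
  -- conjugated back.
  have hinv : (filtMat u N).adjugate * filtMat u N = 1 := by
    rw [adjugate_mul, det_filtMat, one_smul]
  calc _ = (filtMat u N).adjugate * (filtMat u N * corrMat w u N * (filtMat u N)ᵀ * X)
        * filtMat u N := by
        simp only [← Matrix.mul_assoc, hinv, Matrix.one_mul]
    _ = _ := by rw [hTX, Matrix.mul_smul, Matrix.smul_mul, Matrix.mul_one, hinv]

theorem conj_green_apply (u c t d : ℝ) {N : ℕ} (hN : 0 < N) {i j : Fin N} (hi : 2 ≤ (i : ℕ))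
    (hj : 2 ≤ (j : ℕ)) :
    ((filtMat u N)ᵀ * (of fun k l : Fin N => green (solL c t d) (solR c t d N) k l)
      * filtMat u N) i j = cofac u c t d N i j := by
  have hz : ∀ k l, N ≤ max k l → green (solL c t d) (solR c t d N) k l = 0 := fun k l h => by
    rw [green, solR_of_le hN h, mul_zero]
  rw [mul_assoc, mul_apply, cofac]
  rw [← sum_mul_filtMat u (N := N)
    (fun k => filtT u (fun l => green (solL c t d) (solR c t d N) k l) j) _ i hi]
  · refine sum_congr rfl fun k _ => ?_
    rw [transpose_apply, mul_comm, mul_apply,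
      ← sum_mul_filtMat u _ (fun l hl => hz k l (le_max_of_le_right hl)) j hj]
    rfl
  · intro k hk
    simp only [filtT, hz k _ (le_max_of_le_left hk)]
    ring

/-- This is the previous identity multiplied by the adjugate. It is left as a proportion because the
equality of `det` and `lead` is only deduced from it afterwards. -/
theorem corrMat_adjugate {w u c t d : ℝ} (hc : c = (1 + w) * u)
    (ht : t = (w - 1) * u + (1 + w) * u ^ 3) (hd : d = 1 - u ^ 4 - 4 * u ^ 2 * w)
    (hc0 : c ≠ 0) (ht0 : t ≠ 0) {N : ℕ} (hN : 2 ≤ N) {i j : Fin N} (hi : 2 ≤ (i : ℕ))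
    (hj : 2 ≤ (j : ℕ)) :
    lead c t d N * (corrMat w u N).adjugate i j =
      (corrMat w u N).det * cofac u c t d N i j := by
  have h := congrArg (fun M => (corrMat w u N).adjugate * M)
    (corrMat_mul_conj_green hc ht hd hc0 ht0 hN)
  simp only [← Matrix.mul_assoc, adjugate_mul, Matrix.mul_smul, Matrix.smul_mul, Matrix.one_mul,
    Matrix.mul_one] at h
  rw [← conj_green_apply u c t d (by omega) hi hj]
  have h' := congrFun (congrFun h i) j
  simp only [Matrix.smul_apply, smul_eq_mul] at h'
  exact h'.symm

/-- The last diagonal cofactor is the determinant of the next smaller size, so the proportion above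
carries the equality from one size to the next, starting from size 2. -/
theorem corrMat_det {w u c t d : ℝ} (hc : c = (1 + w) * u)
    (ht : t = (w - 1) * u + (1 + w) * u ^ 3) (hd : d = 1 - u ^ 4 - 4 * u ^ 2 * w)
    (hc0 : c ≠ 0) (ht0 : t ≠ 0) (hl : ∀ k, lead c t d k ≠ 0) (N : ℕ) :
    (corrMat w u (N + 2)).det = lead c t d (N + 2) := by
  induction N with
  | zero =>
    have h01 := corr_add w u 0 1
    have h10 := corr_comm w u 1 0
    have h00 : ∀ k, corr w u k k = 1 := fun k => by simpa using corr_add w u k 0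
    rw [det_fin_two]
    simp only [corrMat, of_apply, Fin.val_zero, Fin.val_one, h00, h10, lead]
    simp only [Nat.zero_add] at h01
    rw [h01, hc]
    push_cast
    ring
  | succ N ih =>
    have h := corrMat_adjugate hc ht hd hc0 ht0 (by omega : 2 ≤ N + 2 + 1)
      (i := Fin.last (N + 2)) (j := Fin.last (N + 2)) (by simp) (by simp)
    -- The right solution vanishes past the end, so of the nine terms of the double filter only the
    -- corner one survives; its powers of `-t` cancel.
    have hcof : cofac u c t d (N + 2 + 1) (N + 2) (N + 2) = lead c t d (N + 2) := by
      have hz : ∀ k, N + 2 + 1 ≤ k → solR c t d (N + 2 + 1) k = 0 := fun k hk =>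
        solR_of_le (by omega) hk
      have e : N + 2 + 1 - (N + 1 + 1) = 1 := by omega
      simp only [cofac, filtT, green, max_self, min_self,
        hz (max (N + 2) (N + 2 + 1)) (by omega), hz (max (N + 2) (N + 2 + 2)) (by omega),
        hz (max (N + 2 + 1) (N + 2)) (by omega), hz (max (N + 2 + 2) (N + 2)) (by omega),
        hz (max (N + 2 + 1) (N + 2 + 2)) (by omega), hz (max (N + 2 + 2) (N + 2 + 1)) (by omega),
        hz (N + 2 + 1) (by omega), hz (N + 2 + 2) (by omega)]
      simp only [solL, solR, e, trail]
      have hs := pow_ne_zero (N + 1 + 1) (neg_ne_zero.2 ht0)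
      field_simp
      ring
    rw [adjugate_fin_succ_eq_det_submatrix, Fin.val_last, hcof, Even.neg_one_pow ⟨_, rfl⟩,
      one_mul] at h
    have hsub : (corrMat w u (N + 2 + 1)).submatrix (Fin.last (N + 2)).succAbove
        (Fin.last (N + 2)).succAbove = corrMat w u (N + 2) := by
      ext k l
      simp [corrMat]
    rw [hsub, ih] at h
    exact (mul_right_cancel₀ (hl (N + 2)) h).symm

/-- The minors of the correlation matrix. -/
theorem det_corrMat_submatrix {w u c t d : ℝ} (hc : c = (1 + w) * u)
    (ht : t = (w - 1) * u + (1 + w) * u ^ 3) (hd : d = 1 - u ^ 4 - 4 * u ^ 2 * w)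
    (hc0 : c ≠ 0) (ht0 : t ≠ 0) (hl : ∀ k, lead c t d k ≠ 0) {N : ℕ} (hN : 1 ≤ N)
    {i j : Fin (N + 1)} (hi : 2 ≤ (i : ℕ)) (hj : 2 ≤ (j : ℕ)) :
    ((corrMat w u (N + 1)).submatrix i.succAbove j.succAbove).det =
      (-1) ^ ((i : ℕ) + j) * cofac u c t d (N + 1) j i := by
  obtain ⟨N, rfl⟩ := Nat.exists_eq_succ_of_ne_zero (by omega : N ≠ 0)
  -- The adjugate transposes: its entry `(j, i)` deletes row `i` and column `j`.
  have h := corrMat_adjugate hc ht hd hc0 ht0 (by omega : 2 ≤ N.succ + 1) hj hi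
  rw [adjugate_fin_succ_eq_det_submatrix, corrMat_det hc ht hd hc0 ht0 hl N] at h
  have h' := mul_left_cancel₀ (hl _) h
  rw [← h', ← mul_assoc, ← pow_add, Even.neg_one_pow ⟨_, rfl⟩, one_mul]

/-! ### Positivity -/

/-- Equivalent to `tanh w < w`. After division by `exp (-w)` the expression vanishes at 0 and has
derivative `1 - (1 + 2 y) exp (-2 y)`, positive for `y > 0`. -/
theorem offDiag_pos {w : ℝ} (hw : 0 < w) :
    0 < (w - 1) * Real.exp (-w) + (1 + w) * Real.exp (-w) ^ 3 := by
  have hu := Real.exp_pos (-w)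
  have key : StrictMonoOn (fun y : ℝ => (y - 1) + (1 + y) * Real.exp (-(2 * y)))
      (Set.Ici 0) := by
    apply strictMonoOn_of_deriv_pos (convex_Ici 0)
    · fun_prop
    · intro y hy
      rw [interior_Ici] at hy
      have hd : HasDerivAt (fun y : ℝ => (y - 1) + (1 + y) * Real.exp (-(2 * y)))
          (1 + (1 * Real.exp (-(2 * y)) + (1 + y) * (Real.exp (-(2 * y)) * (-(2 * 1))))) y :=
        ((hasDerivAt_id y).sub_const 1).add
          (((hasDerivAt_id y).const_add 1).mul (((hasDerivAt_id y).const_mul 2).neg.exp))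
      rw [hd.deriv]
      have h1 : 2 * y + 1 < Real.exp (2 * y) :=
        Real.add_one_lt_exp (by have : (0 : ℝ) < y := hy; positivity)
      have h2 : Real.exp (2 * y) * Real.exp (-(2 * y)) = 1 := by
        rw [← Real.exp_add]; simp
      have h3 := Real.exp_pos (-(2 * y))
      nlinarith
  have h := key (Set.self_mem_Ici) (Set.mem_Ici.2 hw.le) hw
  have e : Real.exp (-(2 * w)) = Real.exp (-w) ^ 2 := by
    rw [← Real.exp_nat_mul]; congr 1; push_cast; ring
  simp only [mul_zero, neg_zero, Real.exp_zero, e] at h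
  have h' : 0 < (w - 1) + (1 + w) * Real.exp (-w) ^ 2 := by linarith
  have := mul_pos hu h'
  linarith

/-- The difference factors as `(1 + u) ^ 2 * (1 - u ^ 2 - 2 u w)`, and the last factor is `2 u (sinh
w - w)`. -/
theorem two_mul_offDiag_lt_diag {w : ℝ} (hw : 0 < w) :
    2 * ((w - 1) * Real.exp (-w) + (1 + w) * Real.exp (-w) ^ 3) <
      1 - Real.exp (-w) ^ 4 - 4 * Real.exp (-w) ^ 2 * w := by
  have hu := Real.exp_pos (-w)
  have h1 := Real.self_lt_sinh_iff.2 hw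
  rw [Real.sinh_eq] at h1
  have h2 : Real.exp w * Real.exp (-w) = 1 := by rw [← Real.exp_add]; simp
  have h3 : 0 < 1 - Real.exp (-w) ^ 2 - 2 * Real.exp (-w) * w := by
    nlinarith [mul_lt_mul_of_pos_right h1 hu]
  nlinarith [mul_pos (pow_pos (by linarith : (0 : ℝ) < 1 + Real.exp (-w)) 2) h3]

/-- With `c = (1 + w) u`, the difference is `c (1 - c) + (1 - 2 w u - (1 + w) u ^ 3)`. Both terms
are nonnegative by the quadratic lower bound for `exp w`. This is the base case of the induction for
the leading minors. -/
theorem offDiag_le_minor {w : ℝ} (hw : 0 < w) :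
    (w - 1) * Real.exp (-w) + (1 + w) * Real.exp (-w) ^ 3 ≤
      1 - ((1 + w) * Real.exp (-w)) ^ 2 := by
  have hu := Real.exp_pos (-w)
  have hv := Real.quadratic_le_exp_of_nonneg hw.le
  have hvu : Real.exp w * Real.exp (-w) = 1 := by rw [← Real.exp_add]; simp
  generalize Real.exp (-w) = u at *
  generalize Real.exp w = v at *
  have h1 : w + 1 ≤ v ^ 2 * (v - 2 * w) := by
    have a1 : 1 + 2 * w + 2 * w ^ 2 ≤ v ^ 2 := by nlinarith [pow_pos hw 3, pow_pos hw 4]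
    have a2 : 1 - w + w ^ 2 / 2 ≤ v - 2 * w := by linarith
    have a3 : 0 ≤ 1 - w + w ^ 2 / 2 := by nlinarith [sq_nonneg (w - 1)]
    have a4 := mul_le_mul a1 a2 a3 (sq_nonneg v)
    nlinarith [mul_nonneg (sq_nonneg w) (by nlinarith [sq_nonneg (w - 1/2)] : 0 ≤ 1 / 2 - w
        + w ^ 2)]
  have h2 : 0 ≤ 1 - 2 * w * u - u ^ 3 * w - u ^ 3 := by
    have e : 1 - 2 * w * u - u ^ 3 * w - u ^ 3 = u ^ 3 * (v ^ 2 * (v - 2 * w) - (w + 1)) := by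
      have : u ^ 3 * (v ^ 2 * (v - 2 * w) - (w + 1)) =
        (v * u) ^ 3 - 2 * w * u * (v * u) ^ 2 - u ^ 3 * w - u ^ 3 := by ring
      rw [this, hvu]; ring
    rw [e]
    exact mul_nonneg (pow_pos hu 3).le (by linarith)
  have h3 : (1 + w) * u ≤ 1 := by nlinarith
  nlinarith [mul_nonneg (by positivity : 0 ≤ (1 + w) * u) (by linarith : 0 ≤ 1 - (1 + w) * u)]

/-- Positivity alone does not propagate through the recurrence; the induction also carries the lower
bound `t` for the ratio of consecutive minors, which is preserved because `2 t < d`. -/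
theorem lead_pos {c t d : ℝ} (ht : 0 < t) (hd : 2 * t < d) (hc : t ≤ 1 - c ^ 2) (k : ℕ) :
    0 < lead c t d k := by
  have key : ∀ k, 0 < lead c t d (k + 1) ∧ t * lead c t d (k + 1) ≤ lead c t d (k + 2) := by
    intro k
    induction k with
    | zero => simpa [lead] using hc
    | succ k ih =>
      have h2 : 0 < lead c t d (k + 2) := lt_of_lt_of_le (mul_pos ht ih.1) ih.2
      refine ⟨h2, ?_⟩
      rw [lead]
      nlinarith [mul_le_mul_of_nonneg_left ih.2 ht.le, mul_pos h2 (by linarith : 0 < d - 2 * t)]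
  rcases k with _ | k
  · simp [lead]
  · exact (key k).1

/-! ### The basic constants -/

theorem tau_neg_one (w u : ℝ) : tau w u (-1) = (w - 1) * u + (1 + w) * u ^ 3 := by
  simp [tau]

/-- With `coefA_sub`, this turns the quadratic defining `α₁, α₂`, at the point `-u y`, into `u (t (y
^ 2 + 1) - d y)`. -/
theorem mul_coefB_add (w u : ℝ) :
    u * (coefB w u + tau w u (-1) * u) = tau w u (-1) := by
  rw [tau_neg_one, coefB]; ring

theorem coefA_sub (w u : ℝ) :
    coefA w u - 2 * tau w u (-1) * u = 1 - u ^ 4 - 4 * u ^ 2 * w := by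
  rw [tau_neg_one, coefA]; ring

theorem discr_eq (w u : ℝ) :
    discr w u = (1 - u ^ 4 - 4 * u ^ 2 * w) ^ 2 - 4 * tau w u (-1) ^ 2 := by
  rw [discr, coefA_sub]
  linear_combination -4 * tau w u (-1) * mul_coefB_add w u

theorem coefATilde_eq (w u : ℝ) : coefATilde w u = 1 - ((1 + w) * u) ^ 2 := by
  rw [coefATilde]; ring

theorem mul_coefBTilde (w u : ℝ) : u * coefBTilde w u = tau w u (-1) := by
  rw [tau_neg_one, coefBTilde]; ring

theorem den_eq {w u x : ℝ} :
    den w u (-(u * x)) = -(tau w u (-1) * (x + u)) := by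
  rw [den]
  linear_combination -x * mul_coefB_add w u

theorem tauHat_neg_two (w u : ℝ) : tauHat w u (-2) = 2 * tau w u (-1) * u := by
  simp [tauHat]

theorem tauHat_neg_one (w u : ℝ) :
    tauHat w u (-1) = (1 + w) * u - 3 * (1 + w) * u ^ 3 + 2 * (1 + 2 * w) * u ^ 5 := by
  simp [tauHat]

theorem tauHat_natCast (w u : ℝ) (k : ℕ) :
    tauHat w u k = (1 + k * w) * u ^ k - 3 * (1 + (k + 2) * w) * u ^ (k + 4)
      + 2 * (1 + (k + 3) * w) * u ^ (k + 6) := by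
  rw [tauHat, if_neg (by omega), if_neg (by omega)]
  norm_cast

theorem tauHat_zero (w u : ℝ) :
    tauHat w u 0 = 1 - 3 * (1 + 2 * w) * u ^ 4 + 2 * (1 + 3 * w) * u ^ 6 := by
  have := tauHat_natCast w u 0
  push_cast at this
  rw [this]; ring

theorem tauHat_one (w u : ℝ) :
    tauHat w u 1 = (1 + w) * u - 3 * (1 + 3 * w) * u ^ 5 + 2 * (1 + 4 * w) * u ^ 7 := by
  have := tauHat_natCast w u 1
  push_cast at this
  rw [this]; ring

theorem tauTilde_neg_two (w u : ℝ) : tauTilde w u (-2) = tau w u (-1) * u / 2 := by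
  simp [tauTilde]

theorem tauTilde_neg_one (w u : ℝ) :
    tauTilde w u (-1) = ((2 * w - 1) * u + (1 + 2 * w) * u ^ 5) / 2 := by
  simp [tauTilde]

theorem tauTilde_zero (w u : ℝ) :
    tauTilde w u 0 = (2 - 3 * (1 + w) * u ^ 2 + (1 + 3 * w) * u ^ 6) / 2 := by
  rw [tauTilde, if_neg (by omega), if_neg (by omega)]
  norm_cast
  ring

/-! ### Closed forms of the constants

For a root `x` of `t (x ^ 2 + 1) = d x`, the constants at `α = -u x` simplify. -/

section Constants

variable {w u x : ℝ}

/-- The lemmas `Ck_mul` only clear denominators and hold for any admissible `x`: by `den_eq` the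
denominator is `-t (x + u)`, and its factor `t` cancels against the one in `tauHat w u (-2)`. -/
theorem C7_mul (ht : tau w u (-1) ≠ 0) (hx : x + u ≠ 0) :
    C7 w u (-(u * x)) * (x + u) ^ 2 =
      -2 * u ^ 3 * (w * (2 - 6 * u ^ 2 + 4 * u ^ 4) + (1 - u ^ 2) ^ 2) * (x + u)
        + 2 * w * u ^ 4 * (1 - u ^ 2) ^ 2 + tauHat w u 0 * (x + u) ^ 2 := by
  rw [C7, den_eq, tauHat_neg_two]
  generalize tau w u (-1) = t at *
  field_simp

theorem C3_mul (ht : tau w u (-1) ≠ 0) (hx : x + u ≠ 0) :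
    C3 w u (-(u * x)) * (x + u) ^ 2 =
      tauHat w u (-1) * (x + u) ^ 2 - 2 * u ^ 2 * (w * (1 - 4 * u ^ 2 + 3 * u ^ 4) + (1
        - u ^ 2) ^ 2) * (x + u) + 2 * w * u ^ 3 * (1 - u ^ 2) ^ 2 := by
  rw [C3, den_eq, tauHat_neg_two]
  generalize tau w u (-1) = t at *
  field_simp
  ring

theorem C6_mul (ht : tau w u (-1) ≠ 0) (hx : x + u ≠ 0) :
    C6 w u (-(u * x)) * (x + u) ^ 2 =
      (tauHat w u (-1) * tauTilde w u (-1) - tauHat w u 0 * tauTilde w u (-2)) * (x + u) ^ 2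
        - 2 * u ^ 2 * tauTilde w u (-1) * (w * (1 - 4 * u ^ 2 + 3 * u ^ 4) + (1
          - u ^ 2) ^ 2) * (x + u)
        + 2 * u ^ 3 * tauTilde w u (-2) * (w * (2 - 6 * u ^ 2 + 4 * u ^ 4) + (1
          - u ^ 2) ^ 2) * (x + u)
        + 2 * w * u ^ 3 * (tauTilde w u (-1) - u * tauTilde w u (-2)) * (1 - u ^ 2) ^ 2 := by
  rw [C6, den_eq, tauHat_neg_two]
  generalize tau w u (-1) = t at *
  field_simp
  ring

theorem C1_mul (hu : u ≠ 0) (ht : tau w u (-1) ≠ 0) (hx : x + u ≠ 0) :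
    C1 w u (-(u * x)) * (tau w u (-1) * u ^ 4) * (x + u) ^ 2 =
      -2 * u ^ 3 * tauTilde w u 0 * (w * (2 - 6 * u ^ 2 + 4 * u ^ 4) + (1 - u ^ 2) ^ 2) * (x
        + u) + 2 * w * u ^ 4 * (1 - u ^ 2) ^ 2 * tauTilde w u 0
        + (tauHat w u 0 * tauTilde w u 0 - tauHat w u 1 * tauTilde w u (-1)) * (x + u) ^ 2
        + 2 * u ^ 4 * tauTilde w u (-1) * (w * (3 - 8 * u ^ 2 + 5 * u ^ 4) + (1
          - u ^ 2) ^ 2) * (x + u) - 2 * w * u ^ 5 * (1 - u ^ 2) ^ 2 * tauTilde w u (-1) := by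
  rw [C1, den_eq, tauHat_neg_two]
  generalize tau w u (-1) = t at *
  field_simp
  ring

theorem C2_mul (hu : u ≠ 0) (ht : tau w u (-1) ≠ 0) (hx : x + u ≠ 0) :
    C2 w u (-(u * x)) * (tau w u (-1) * u ^ 4) * (x + u) ^ 2 =
      -w * (2 - 3 * u ^ 2 + u ^ 6) * u ^ 3 * (w * (2 - 6 * u ^ 2 + 4 * u ^ 4) + (1
        - u ^ 2) ^ 2) * (x + u) + w ^ 2 * (2 - 3 * u ^ 2 + u ^ 6) * (1 - u ^ 2) ^ 2 * u ^ 4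
        + w * tauHat w u 0 * (2 - 3 * u ^ 2 + u ^ 6) / 2 * (x + u) ^ 2 + 2 * w * (1
          - u ^ 2) ^ 2 * tauTilde w u (-1) * u ^ 4 * (x + u)
        - w * (1 - 3 * u ^ 4 + 2 * u ^ 6) * tauTilde w u (-1) * u * (x + u) ^ 2 := by
  rw [C2, den_eq, tauHat_neg_two]
  generalize tau w u (-1) = t at *
  field_simp
  ring

theorem C4_mul (hu : u ≠ 0) (ht : tau w u (-1) ≠ 0) (hx : x + u ≠ 0) :
    C4 w u (-(u * x)) * (tau w u (-1) * u ^ 4) * (x + u) ^ 2 =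
      tauHat w u (-1) * tauTilde w u 0 * (x + u) ^ 2 - 2 * u ^ 2 * tauTilde w u 0 * (w * (1
        - 4 * u ^ 2 + 3 * u ^ 4) + (1 - u ^ 2) ^ 2) * (x + u)
        + 2 * w * u ^ 3 * tauTilde w u 0 * (1 - u ^ 2) ^ 2
          - tauHat w u 1 * tauTilde w u (-2) * (x + u) ^ 2
        + 2 * u ^ 4 * tauTilde w u (-2) * (w * (3 - 8 * u ^ 2 + 5 * u ^ 4) + (1
          - u ^ 2) ^ 2) * (x + u) - 2 * w * u ^ 5 * tauTilde w u (-2) * (1 - u ^ 2) ^ 2 := by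
  rw [C4, den_eq, tauHat_neg_two]
  generalize tau w u (-1) = t at *
  field_simp
  ring

theorem C5_mul (hu : u ≠ 0) (ht : tau w u (-1) ≠ 0) (hx : x + u ≠ 0) :
    C5 w u (-(u * x)) * (tau w u (-1) * u ^ 4) * (x + u) ^ 2 =
      w * tauHat w u (-1) * (2 - 3 * u ^ 2 + u ^ 6) / 2 * (x + u) ^ 2 - w * (2 - 3 * u ^ 2
        + u ^ 6) * u ^ 2 * (w * (1 - 4 * u ^ 2 + 3 * u ^ 4) + (1 - u ^ 2) ^ 2) * (x + u)
        + w ^ 2 * (2 - 3 * u ^ 2 + u ^ 6) * (1 - u ^ 2) ^ 2 * u ^ 3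
          + 2 * w * u ^ 4 * tauTilde w u (-2) * (1 - u ^ 2) ^ 2 * (x + u)
        - w * (1 - 3 * u ^ 4 + 2 * u ^ 6) * tauTilde w u (-2) * u * (x + u) ^ 2 := by
  rw [C5, den_eq, tauHat_neg_two]
  generalize tau w u (-1) = t at *
  field_simp
  ring

theorem C7_mul_root (ht : tau w u (-1) ≠ 0) (hx : x + u ≠ 0)
    (hκ : (1 - u ^ 4 - 4 * u ^ 2 * w) * x = tau w u (-1) * (x ^ 2 + 1)) :
    C7 w u (-(u * x)) * x = tau w u (-1) * (x ^ 2 + 1 + 4 * u * x + 4 * u ^ 2 * x ^ 2) := by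
  have h7 := C7_mul (w := w) ht hx
  refine mul_right_cancel₀ (pow_ne_zero 2 hx) ?_
  simp only [tauHat_zero, tau_neg_one] at h7 hκ ⊢
  -- The multiplier of `hκ` is the quotient of the difference of the two sides by the equation of
  -- the root; likewise in the lemmas below.
  linear_combination x * h7 + (x ^ 2 + 2 * u * x + u ^ 2 + 4 * u ^ 2 * x ^ 2 + 2 * u ^ 3 * x) * hκ

theorem C3_eq (ht : tau w u (-1) ≠ 0) (hx : x + u ≠ 0)
    (hκ : (1 - u ^ 4 - 4 * u ^ 2 * w) * x = tau w u (-1) * (x ^ 2 + 1)) :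
    C3 w u (-(u * x)) = tau w u (-1) * (1 + 2 * u * x) := by
  have h3 := C3_mul (w := w) ht hx
  refine mul_right_cancel₀ (pow_ne_zero 2 hx) ?_
  simp only [tauHat_neg_one, tau_neg_one] at h3 hκ ⊢
  linear_combination h3 + (2 * u * x) * hκ

theorem C6_eq (ht : tau w u (-1) ≠ 0) (hx : x + u ≠ 0)
    (hκ : (1 - u ^ 4 - 4 * u ^ 2 * w) * x = tau w u (-1) * (x ^ 2 + 1)) :
    C6 w u (-(u * x)) = (tau w u (-1) * (1 + u * x)) ^ 2 := by
  have h6 := C6_mul (w := w) ht hx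
  refine mul_right_cancel₀ (pow_ne_zero 2 hx) ?_
  simp only [tauHat_neg_one, tauHat_zero, tauTilde_neg_two, tauTilde_neg_one,
      tau_neg_one] at h6 hκ ⊢
  linear_combination h6 + (- u ^ 2 * x + 2 * u ^ 2 * x * w - u ^ 3 * x ^ 2 + u ^ 3 * x ^ 2 * w
      + u ^ 5 * x ^ 2
      + u ^ 5 * x ^ 2 * w + u ^ 6 * x + 2 * u ^ 6 * x * w) * hκ

/-- `C1` and `C2` enter the minors through two combinations: this one multiplies the pure power `p₁
^ (m - 4)`, and the one in `C1_C2_inner` the mixed power. The subtracted term matches the Wronskian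
correction in `cofac_diag`. -/
theorem C1_C2_outer (hu : u ≠ 0) (ht : tau w u (-1) ≠ 0) (hx : x + u ≠ 0)
    (hκ : (1 - u ^ 4 - 4 * u ^ 2 * w) * x = tau w u (-1) * (x ^ 2 + 1)) :
    (C1 w u (-(u * x)) * (x + u)
        - u * C2 w u (-(u * x))) * (tau w u (-1) * u ^ 4) = tau w u (-1) ^ 2 * ((1
          + u * x) ^ 2 * (x + u) ^ 2 * x
        - (2 * u * x + 2 * u ^ 3 * x + u ^ 2 * (x ^ 2 + 1)) * (x ^ 2 - 1) * x) := by
  have h1 := C1_mul (w := w) hu ht hx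
  have h2 := C2_mul (w := w) hu ht hx
  refine mul_right_cancel₀ (pow_ne_zero 2 hx) ?_
  simp only [tauHat_zero, tauHat_one, tauTilde_neg_one, tauTilde_zero, tau_neg_one] at h1 h2 hκ ⊢
  linear_combination (x + u) * h1 + (-u) * h2 + (x ^ 2 + 2 * u * x - u * x ^ 3 + u * x ^ 3 * w
      + u ^ 2 - 2 * u ^ 2 * x ^ 2 + 2 * u ^
      2 * x ^ 2 * w - 3 * u ^ 3 * x - 3 * u ^ 3 * x * w - 3 * u ^ 3 * x ^ 3 + 5 * u ^ 3 *
      x ^ 3 * w - 2 * u ^ 4 - 2 * u ^ 4 * w - 6 * u ^ 4 * x ^ 2 + 2 * u ^ 4 * x ^ 2 * w -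
      2 * u ^ 5 * x + 2 * u ^ 5 * x * w + 3 * u ^ 5 * x ^ 3 + 5 * u ^ 5 * x ^ 3 * w + u ^
      6 + 2 * u ^ 6 * w + 6 * u ^ 6 * x ^ 2 + 10 * u ^ 6 * x ^ 2 * w + 3 * u ^ 7 * x + 5 *
      u ^ 7 * x * w + u ^ 7 * x ^ 3 + u ^ 7 * x ^ 3 * w + u ^ 8 * x ^ 2 + 2 * u ^ 8 * x ^
      2 * w) * hκ

theorem C1_C2_inner (hu : u ≠ 0) (ht : tau w u (-1) ≠ 0) (hx : x + u ≠ 0)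
    (hκ : (1 - u ^ 4 - 4 * u ^ 2 * w) * x = tau w u (-1) * (x ^ 2 + 1)) :
    (C1 w u (-(u * x)) * (1 + u * x)
        - u * x * C2 w u (-(u * x))) * (tau w u (-1) * u ^ 4) * x ^ 2 = tau w u (-1) ^ 2 * (1
          + u * x) ^ 4 := by
  have h1 := C1_mul (w := w) hu ht hx
  have h2 := C2_mul (w := w) hu ht hx
  refine mul_right_cancel₀ (pow_ne_zero 2 hx) ?_
  simp only [tauHat_zero, tauHat_one, tauTilde_neg_one, tauTilde_zero, tau_neg_one] at h1 h2 hκ ⊢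
  linear_combination (1 + u * x) * x ^ 2 * h1 + (-u * x) * x ^ 2 * h2 + (x ^ 3 + u * x ^ 2
      + u * x ^ 2 * w - u ^ 2 * x + 2 * u ^ 2 * x * w - u ^ 3 + u ^ 3 *
      w - 5 * u ^ 3 * x ^ 2 + u ^ 3 * x ^ 2 * w - 2 * u ^ 4 * x + 2 * u ^ 4 * x * w - 6 *
      u ^ 4 * x ^ 3 - 2 * u ^ 4 * x ^ 3 * w + u ^ 5 + u ^ 5 * w + u ^ 5 * x ^ 2 + 5 * u ^
      5 * x ^ 2 * w - u ^ 5 * x ^ 4 + u ^ 5 * x ^ 4 * w + 3 * u ^ 6 * x + 4 * u ^ 6 * x *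
      w + 4 * u ^ 6 * x ^ 3 + 8 * u ^ 6 * x ^ 3 * w + 3 * u ^ 7 * x ^ 2 + 5 * u ^ 7 * x ^
      2 * w + u ^ 7 * x ^ 4 + u ^ 7 * x ^ 4 * w + u ^ 8 * x ^ 3 + 2 * u ^ 8 * x ^ 3 * w) * hκ

theorem C4_C5_outer (hu : u ≠ 0) (ht : tau w u (-1) ≠ 0) (hx : x + u ≠ 0)
    (hκ : (1 - u ^ 4 - 4 * u ^ 2 * w) * x = tau w u (-1) * (x ^ 2 + 1)) :
    (C4 w u (-(u * x)) * (x + u)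
        - u * C5 w u (-(u * x))) * (tau w u (-1) * u ^ 4) = tau w u (-1) ^ 2 * ((1
          + u * x) ^ 2 * (x + u) ^ 2 - u ^ 2 * x ^ 2 * (x ^ 2 - 1)) := by
  have h4 := C4_mul (w := w) hu ht hx
  have h5 := C5_mul (w := w) hu ht hx
  refine mul_right_cancel₀ (pow_ne_zero 2 hx) ?_
  simp only [tauHat_neg_one, tauHat_one, tauTilde_neg_two, tauTilde_zero, tau_neg_one] at h4 h5 hκ ⊢
  linear_combination (x + u) * h4 + (-u) * h5 + (u * x ^ 2 + u * x ^ 2 * w - 2 * u ^ 2 * x ^ 3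
      + 2 * u ^ 2 * x ^ 3 * w - u ^ 3 + u ^
      3 * w - 6 * u ^ 3 * x ^ 2 + 2 * u ^ 3 * x ^ 2 * w - 3 * u ^ 4 * x + 4 * u ^ 4 * x *
      w + 4 * u ^ 4 * x ^ 3 * w + u ^ 5 + u ^ 5 * w + 2 * u ^ 5 * x ^ 2 + 6 * u ^ 5 * x ^
      2 * w + 2 * u ^ 6 * x + 2 * u ^ 6 * x * w + 2 * u ^ 6 * x ^ 3 + 2 * u ^ 6 * x ^ 3 *
      w + 3 * u ^ 7 * x ^ 2 + 5 * u ^ 7 * x ^ 2 * w + u ^ 8 * x + 2 * u ^ 8 * x * w) * hκ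

theorem C4_C5_inner (hu : u ≠ 0) (ht : tau w u (-1) ≠ 0) (hx : x + u ≠ 0)
    (hκ : (1 - u ^ 4 - 4 * u ^ 2 * w) * x = tau w u (-1) * (x ^ 2 + 1)) :
    (C4 w u (-(u * x)) * (1 + u * x)
        - u * x * C5 w u (-(u * x))) * (tau w u (-1) * u ^ 4) * x = tau w u (-1) ^ 2 * (1
          + u * x) ^ 4 := by
  have h4 := C4_mul (w := w) hu ht hx
  have h5 := C5_mul (w := w) hu ht hx
  refine mul_right_cancel₀ (pow_ne_zero 2 hx) ?_
  simp only [tauHat_neg_one, tauHat_one, tauTilde_neg_two, tauTilde_zero, tau_neg_one] at h4 h5 hκ ⊢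
  linear_combination (1 + u * x) * x * h4 + (-u * x) * x * h5 + (u * x ^ 2 + u * x ^ 2 * w
      - 2 * u ^ 2 * x + 2 * u ^ 2 * x * w - u ^ 3 + u ^ 3 * w -
      6 * u ^ 3 * x ^ 2 + 2 * u ^ 3 * x ^ 2 * w + 4 * u ^ 4 * x * w - 3 * u ^ 4 * x ^ 3 +
      4 * u ^ 4 * x ^ 3 * w + u ^ 5 + u ^ 5 * w + 3 * u ^ 5 * x ^ 2 + 5 * u ^ 5 * x ^ 2 *
      w - u ^ 5 * x ^ 4 + u ^ 5 * x ^ 4 * w + 2 * u ^ 6 * x + 2 * u ^ 6 * x * w + 2 * u ^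
      6 * x ^ 3 + 2 * u ^ 6 * x ^ 3 * w + 2 * u ^ 7 * x ^ 2 + 4 * u ^ 7 * x ^ 2 * w + u ^
      7 * x ^ 4 + u ^ 7 * x ^ 4 * w + u ^ 8 * x ^ 3 + 2 * u ^ 8 * x ^ 3 * w) * hκ

end Constants

/-! ### Cofactors as products -/

theorem solL_rec_succ {c t d : ℝ} (ht : t ≠ 0) (k : ℕ) :
    t * solL c t d (k + 1) + d * solL c t d (k + 2) + t * solL c t d (k + 3) = 0 :=
  solL_rec (c := c) (d := d) ht (k + 1)

/-- The two filter windows meet in at most one position, so the order of the indices is fixed and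
the kernel separates. -/
theorem cofac_far (u c t d : ℝ) (N i q : ℕ) :
    cofac u c t d N (i + 2 + q) i =
      filtT u (solL c t d) i * filtT u (solR c t d N) (i + 2 + q) := by
  have e : ∀ a b, a ≤ 2 → green (solL c t d) (solR c t d N) (i + 2 + q + b) (i + a) =
      solL c t d (i + a) * solR c t d N (i + 2 + q + b) := fun a b h =>
    green_of_ge _ _ (by omega)
  have e0 := e 0 0 (by omega)
  have e1 := e 1 0 (by omega)
  have e2 := e 2 0 (by omega)
  have e3 := e 0 1 (by omega)
  have e4 := e 0 2 (by omega)
  simp only [Nat.add_zero] at e0 e1 e2 e3 e4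
  simp only [cofac, filtT, e0, e1, e2, e3, e4, e 1 1 (by omega), e 1 2 (by omega),
    e 2 1 (by omega), e 2 2 (by omega)]
  ring

theorem wronskian_succ {c t d : ℝ} (hc : c ≠ 0) (ht : t ≠ 0) {N k : ℕ} (hk : k + 1 < N) :
    solL c t d (k + 1) * solR c t d N (k + 2) - solL c t d (k + 2) * solR c t d N (k + 1) =
      lead c t d N / t := by
  have h := solL_solR_wronskian (d := d) hc ht (by omega) hk
  rw [← h, offT, mul_div_cancel_left₀ _ ht]

/-- Exactly one pair of the overlapping windows is in the opposite order, with weight `u ^ 2`;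
exchanging it costs one Wronskian. -/
theorem cofac_adjacent {u c t d : ℝ} (hc : c ≠ 0) (ht : t ≠ 0) {N i : ℕ} (hi : i + 2 < N) :
    cofac u c t d N (i + 2) (i + 1) =
      filtT u (solL c t d) (i + 1) * filtT u (solR c t d N) (i + 2)
        + u ^ 2 * (lead c t d N / t) := by
  have hW := wronskian_succ (d := d) hc ht hi
  simp only [cofac, filtT, Nat.add_assoc, Nat.reduceAdd]
  simp only [green_of_ge _ _ (show i + 1 ≤ i + 2 by omega), green_of_ge _ _ (le_refl (i + 2)),
    green_of_le _ _ (show i + 2 ≤ i + 3 by omega), green_of_ge _ _ (show i + 1 ≤ i + 3 by omega),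
    green_of_ge _ _ (show i + 2 ≤ i + 3 by omega), green_of_ge _ _ (le_refl (i + 3)),
    green_of_ge _ _ (show i + 1 ≤ i + 4 by omega), green_of_ge _ _ (show i + 2 ≤ i + 4 by omega),
    green_of_ge _ _ (show i + 3 ≤ i + 4 by omega)]
  linear_combination u ^ 2 * hW

/-- Three pairs are in the opposite order: two of neighbours, with weights `-2 u` and `-2 u ^ 3`,
and one at distance two, with weight `u ^ 2`. The two-step Wronskian of the last is `-(d / t)` times
the one-step one. -/
theorem cofac_diag {u c t d : ℝ} (hc : c ≠ 0) (ht : t ≠ 0) {N i : ℕ} (hi : i + 2 < N) :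
    cofac u c t d N (i + 1) (i + 1) =
      filtT u (solL c t d) (i + 1) * filtT u (solR c t d N) (i + 1)
        - (2 * u + 2 * u ^ 3 + u ^ 2 * (d / t)) * (lead c t d N / t) := by
  have hW := wronskian_succ (d := d) hc ht hi
  have hW' := wronskian_succ (d := d) hc ht (by omega : i + 1 < N)
  have hg := solL_rec_succ (c := c) (d := d) ht i
  have hh : t * solR c t d N (i + 1) + d * solR c t d N (i + 2) + t * solR c t d N (i + 3) = 0 :=
    solR_rec (t := t) (d := d) hc hi
  have h2 : solL c t d (i + 1) * solR c t d N (i + 3) - solL c t d (i + 3) * solR c t d N (i + 1) =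
      -(d / t) * (lead c t d N / t) := by
    rw [← hW']
    field_simp
    linear_combination solL c t d (i + 1) * hh - solR c t d N (i + 1) * hg
  simp only [cofac, filtT, Nat.add_assoc, Nat.reduceAdd]
  simp only [green_of_ge _ _ (le_refl (i + 1)), green_of_le _ _ (show i + 1 ≤ i + 2 by omega),
    green_of_le _ _ (show i + 1 ≤ i + 3 by omega),
    green_of_ge _ _ (show i + 1 ≤ i + 2 by omega), green_of_ge _ _ (le_refl (i + 2)),
    green_of_le _ _ (show i + 2 ≤ i + 3 by omega), green_of_ge _ _ (show i + 1 ≤ i + 3 by omega),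
    green_of_ge _ _ (show i + 2 ≤ i + 3 by omega), green_of_ge _ _ (le_refl (i + 3))]
  linear_combination (-2 * u) * hW' + (-2 * u ^ 3) * hW + u ^ 2 * h2

/-! ### Closed forms in terms of the roots `t x`, `t z` of the characteristic polynomial -/

theorem lead_closed {c t d x z : ℝ} (hxz : x * z = 1) (hne : x ≠ z) (hd : d = t * (x + z))
    (k : ℕ) :
    lead c t d (k + 2) = t ^ k * (((1 - c ^ 2) * x - t) * x ^ k - ((1 - c ^ 2) * z - t) * z ^ k)
      / (x - z) := by
  have h0 : x - z ≠ 0 := sub_ne_zero.2 hne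
  rw [eq_div_iff h0]
  induction k using Nat.twoStepInduction with
  | zero => simp only [lead]; ring
  | one =>
    simp only [lead, hd]
    ring
  | more k ih1 ih2 =>
    rw [lead, sub_mul, mul_assoc, mul_assoc, ih1, ih2, hd]
    linear_combination (t ^ (k + 2) * (((1 - c ^ 2) * x - t) * x ^ k
      - ((1 - c ^ 2) * z - t) * z ^ k)) * hxz

theorem trail_closed {t d x z : ℝ} (hxz : x * z = 1) (hne : x ≠ z) (hd : d = t * (x + z))
    (k : ℕ) : trail t d k * t = t ^ k * (x ^ k - z ^ k) / (x - z) := by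
  have h0 : x - z ≠ 0 := sub_ne_zero.2 hne
  rw [eq_div_iff h0]
  induction k using Nat.twoStepInduction with
  | zero => simp [trail]
  | one => simp only [trail]; ring
  | more k ih1 ih2 =>
    rw [trail, sub_mul, sub_mul, mul_assoc d, mul_assoc (t ^ 2), mul_assoc, mul_assoc (t ^ 2),
      ih1, ih2, hd]
    linear_combination (t ^ (k + 2) * (x ^ k - z ^ k)) * hxz

/-- The left solution is a combination of `(-x) ^ k` and `(-z) ^ k`, and the transposed filter
multiplies `(-x) ^ k` by `(1 + u x) ^ 2`. For the right solution the powers run backwards, so `x`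
and `z` trade factors. -/
theorem filtT_solL_closed {u c t d x z : ℝ} (ht : t ≠ 0) (hxz : x * z = 1) (hne : x ≠ z)
    (hd : d = t * (x + z)) (k : ℕ) :
    filtT u (solL c t d) (k + 2) = (-1) ^ k *
      (((1 - c ^ 2) * x - t) * (1 + u * x) ^ 2 * x ^ k
        - ((1 - c ^ 2) * z - t) * (1 + u * z) ^ 2 * z ^ k) / (t ^ 2 * (x - z)) := by
  have h0 : x - z ≠ 0 := sub_ne_zero.2 hne
  have hs : ((-1 : ℝ)) ^ k * (-1) ^ k = 1 := by rw [← mul_pow]; simp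
  have hl := lead_closed (c := c) hxz hne hd
  have e : ∀ e, solL c t d (k + e + 2) = (-1) ^ k * (-1) ^ e *
      (((1 - c ^ 2) * x - t) * x ^ (k + e) - ((1 - c ^ 2) * z - t) * z ^ (k + e)) /
        (t ^ 2 * (x - z)) := by
    intro e
    have h1 : (-t) ^ (k + e + 2) = (-1) ^ k * (-1) ^ e * t ^ (k + e) * t ^ 2 := by
      rw [neg_pow]; ring
    have h2 : ((-1 : ℝ)) ^ e * (-1) ^ e = 1 := by rw [← mul_pow]; simp
    have h3 : (-1 : ℝ) ^ k ≠ 0 := by simp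
    have h4 : (-1 : ℝ) ^ e ≠ 0 := by simp
    have h5 : t ^ (k + e) ≠ 0 := pow_ne_zero _ ht
    change lead c t d (k + e + 2) / (-t) ^ (k + e + 2) = _
    rw [hl, h1, div_div, div_eq_div_iff (by positivity) (by positivity)]
    linear_combination (-(t ^ (k + e) * (((1 - c ^ 2) * x - t) * x ^ (k + e)
      - ((1 - c ^ 2) * z - t) * z ^ (k + e)) * t ^ 2 * (x - z))) *
        ((-1) ^ e * (-1) ^ e * hs + h2)
  have e0 := e 0
  have e1 := e 1
  have e2 := e 2
  simp only [Nat.add_zero] at e0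
  rw [filtT, e0, show k + 2 + 1 = k + 1 + 2 by ring, e1, e2]
  field_simp
  ring

theorem filtT_solR_closed {u c t d x z : ℝ} (hxz : x * z = 1) (hne : x ≠ z)
    (hd : d = t * (x + z)) (ht : t ≠ 0) (j s : ℕ) :
    filtT u (solR c t d (j + 1 + 2 + s)) (j + 1) = (-1) ^ (j + 1) * t ^ (j + 1 + s + 1) *
      ((1 + u * z) ^ 2 * x ^ (s + 2) - (1 + u * x) ^ 2 * z ^ (s + 2)) / (x - z) := by
  have h0 : x - z ≠ 0 := sub_ne_zero.2 hne
  have hl := fun k => eq_div_of_mul_eq ht (trail_closed hxz hne hd k)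
  have e0 : j + 1 + 2 + s - (j + 1) = s + 2 := by omega
  have e1 : j + 1 + 2 + s - (j + 1 + 1) = s + 1 := by omega
  have e2 : j + 1 + 2 + s - (j + 2 + 1) = s := by omega
  simp only [filtT, solR, e0, e1, e2, hl]
  have h1 : ∀ k, (-t) ^ k = (-1) ^ k * t ^ k := fun k => neg_pow t k
  simp only [h1]
  have hx1 : x ^ (s + 1) = x ^ (s + 2) * z := by
    linear_combination (-(x ^ (s + 1))) * hxz
  have hx0 : x ^ s = x ^ (s + 2) * z ^ 2 := by
    linear_combination (-(x ^ s) * (1 + x * z)) * hxz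
  have hz1 : z ^ (s + 1) = z ^ (s + 2) * x := by
    linear_combination (-(z ^ (s + 1))) * hxz
  have hz0 : z ^ s = z ^ (s + 2) * x ^ 2 := by
    linear_combination (-(z ^ s) * (1 + x * z)) * hxz
  rw [hx1, hx0, hz1, hz0]
  field_simp
  ring

theorem filtT_solR_last (u c t d : ℝ) (j : ℕ) :
    filtT u (solR c t d (j + 2)) (j + 1) = (-1) ^ (j + 1) * t ^ (j + 1) := by
  have e0 : j + 2 - (j + 1) = 1 := by omega
  have e1 : j + 2 - (j + 1 + 1) = 0 := by omega
  -- Truncated subtraction is harmless: it yields `trail t d 0 = 0`, the right value past the end.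
  have e2 : j + 2 - (j + 2 + 1) = 0 := by omega
  simp only [filtT, solR, e0, e1, e2, trail]
  rw [neg_pow t]
  ring

/-! ### Passage to the roots -/

/-- The standing assumptions: `x` and `z = x⁻¹` are the roots of `t (y ^ 2
    + 1) = d y`, where `t` and
`d` are the entries of the tridiagonal Toeplitz matrix, and the leading minors do not vanish. -/
structure Roots (w u x z : ℝ) : Prop where
  u_pos : 0 < u
  t_pos : 0 < tau w u (-1)
  offDiag_ne : (1 + w) * u ≠ 0
  lead_ne : ∀ k, lead ((1 + w) * u) (tau w u (-1)) (1 - u ^ 4 - 4 * u ^ 2 * w) k ≠ 0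
  x_pos : 0 < x
  z_pos : 0 < z
  mul_eq : x * z = 1
  ne : x ≠ z
  diag_eq : 1 - u ^ 4 - 4 * u ^ 2 * w = tau w u (-1) * (x + z)

theorem exists_roots {w : ℝ} (hw : 0 < w) :
    ∃ x z, Roots w (Real.exp (-w)) x z ∧ 0 < discr w (Real.exp (-w)) ∧
      alpha1 w (Real.exp (-w)) = -(Real.exp (-w) * x) ∧
      alpha2 w (Real.exp (-w)) = -(Real.exp (-w) * z) := by
  have hu := Real.exp_pos (-w)
  have ht := offDiag_pos hw
  have hd := two_mul_offDiag_lt_diag hw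
  have hm := offDiag_le_minor hw
  generalize Real.exp (-w) = u at *
  rw [← tau_neg_one] at ht hd hm
  have hdisc := discr_eq w u
  have hlead := lead_pos ht hd hm
  have hb := mul_coefB_add w u
  have hA := coefA_sub w u
  generalize hde : 1 - u ^ 4 - 4 * u ^ 2 * w = d at *
  generalize hte : tau w u (-1) = t at *
  have hpos : 0 < discr w u := by rw [hdisc]; nlinarith
  have hsq := Real.sq_sqrt hpos.le
  have hs := Real.sqrt_pos.2 hpos
  have hlt : √(discr w u) < d := by
    refine lt_of_pow_lt_pow_left₀ 2 (by linarith) ?_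
    rw [hsq, hdisc]
    nlinarith
  have hb' : coefB w u + t * u = t / u := by
    rw [eq_div_iff hu.ne', mul_comm, hb]
  -- The larger root is `x`, since `α₁` carries the minus sign and equals `-(u x)`.
  refine ⟨(d + √(discr w u)) / (2 * t), (d - √(discr w u)) / (2 * t),
    ⟨hu, hte.symm ▸ ht, (mul_pos (by linarith) hu).ne', fun k => ?_, div_pos (by linarith)
        (by linarith),
      div_pos (by linarith) (by linarith), ?_, fun h => ?_, ?_⟩, hpos, ?_, ?_⟩
  · rw [hte, hde]
    exact (hlead k).ne'
  · field_simp
    linear_combination -hsq - hdisc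
  · rw [div_left_inj' (by positivity)] at h
    linarith
  · rw [hde, hte]
    field_simp
    ring
  · rw [alpha1, hte, hA, hb']
    field_simp
    ring
  · rw [alpha2, hte, hA, hb']
    field_simp
    ring

/-- Identifies `e_l`, up to the factor `-u`, with the coefficient of `x ^ k` in the closed form of
the leading minors. -/
theorem weight_eq (w u x : ℝ) :
    coefATilde w u * -(u * x) + u ^ 2 * coefBTilde w u =
      -(u * ((1 - ((1 + w) * u) ^ 2) * x - tau w u (-1))) := by
  rw [coefATilde_eq]
  linear_combination u * mul_coefBTilde w u

namespace Roots

variable {w u x z : ℝ}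

theorem root_left (S : Roots w u x z) :
    (1 - u ^ 4 - 4 * u ^ 2 * w) * x = tau w u (-1) * (x ^ 2 + 1) := by
  rw [S.diag_eq]
  linear_combination tau w u (-1) * S.mul_eq

theorem symm (S : Roots w u x z) : Roots w u z x :=
  ⟨S.u_pos, S.t_pos, S.offDiag_ne, S.lead_ne, S.z_pos, S.x_pos, by rw [mul_comm, S.mul_eq],
    S.ne.symm, by rw [S.diag_eq, add_comm]⟩

theorem den_ne (S : Roots w u x z) : den w u (-(u * x)) ≠ 0 := by
  rw [den_eq]
  exact neg_ne_zero.2 (mul_pos S.t_pos (add_pos S.x_pos S.u_pos)).ne'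

theorem z_eq (S : Roots w u x z) : z = 1 / x := by
  rw [eq_div_iff S.x_pos.ne', mul_comm, S.mul_eq]

/-- Once `z` is replaced by `1 / x`, the denominator `x - z` becomes `(x ^ 2 - 1) / x`. -/
theorem sq_sub_one_ne (S : Roots w u x z) : x ^ 2 - 1 ≠ 0 := by
  intro h
  apply S.ne
  have : x * (x - z) = 0 := by linear_combination h - S.mul_eq
  rcases mul_eq_zero.1 this with h | h
  · exact absurd h S.x_pos.ne'
  · linarith

theorem C7_eq (S : Roots w u x z) :
    C7 w u (-(u * x)) = tau w u (-1) * (x + z + 4 * u + 4 * u ^ 2 * x) := by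
  have h := C7_mul_root S.t_pos.ne' (add_pos S.x_pos S.u_pos).ne' S.root_left
  linear_combination z * h
    + (tau w u (-1) * (x + 4 * u + 4 * u ^ 2 * x) - C7 w u (-(u * x))) * S.mul_eq

theorem C3_eq (S : Roots w u x z) :
    C3 w u (-(u * x)) = tau w u (-1) * (1 + 2 * u * x) :=
  CovMatrix.C3_eq S.t_pos.ne' (add_pos S.x_pos S.u_pos).ne' S.root_left

theorem C6_eq (S : Roots w u x z) :
    C6 w u (-(u * x)) = (tau w u (-1) * (1 + u * x)) ^ 2 :=
  CovMatrix.C6_eq S.t_pos.ne' (add_pos S.x_pos S.u_pos).ne' S.root_left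

theorem C1_C2_outer (S : Roots w u x z) :
    (C1 w u (-(u * x)) * (x + u) - u * C2 w u (-(u * x))) * (tau w u (-1) * u ^ 4) =
      tau w u (-1) ^ 2 * ((1 + u * x) ^ 2 * (x + u) ^ 2 * x
        - (2 * u * x + 2 * u ^ 3 * x + u ^ 2 * (x ^ 2 + 1)) * (x ^ 2 - 1) * x) :=
  CovMatrix.C1_C2_outer S.u_pos.ne' S.t_pos.ne' (add_pos S.x_pos S.u_pos).ne' S.root_left

theorem C1_C2_inner (S : Roots w u x z) :
    (C1 w u (-(u * x)) * (z + u) - u * C2 w u (-(u * x))) * (tau w u (-1) * u ^ 4) =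
      tau w u (-1) ^ 2 * ((1 + u * x) ^ 4 * z ^ 3) := by
  have h := CovMatrix.C1_C2_inner S.u_pos.ne' S.t_pos.ne' (add_pos S.x_pos S.u_pos).ne'
    S.root_left
  have hx := S.x_pos.ne'
  rw [S.z_eq]
  field_simp
  linear_combination h

theorem C4_C5_outer (S : Roots w u x z) :
    (C4 w u (-(u * x)) * (x + u) - u * C5 w u (-(u * x))) * (tau w u (-1) * u ^ 4) =
      tau w u (-1) ^ 2 * ((1 + u * x) ^ 2 * (x + u) ^ 2 - u ^ 2 * x ^ 2 * (x ^ 2 - 1)) :=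
  CovMatrix.C4_C5_outer S.u_pos.ne' S.t_pos.ne' (add_pos S.x_pos S.u_pos).ne' S.root_left

theorem C4_C5_inner (S : Roots w u x z) :
    (C4 w u (-(u * x)) * (z + u) - u * C5 w u (-(u * x))) * (tau w u (-1) * u ^ 4) =
      tau w u (-1) ^ 2 * ((1 + u * x) ^ 4 * z ^ 2) := by
  have h := CovMatrix.C4_C5_inner S.u_pos.ne' S.t_pos.ne' (add_pos S.x_pos S.u_pos).ne'
    S.root_left
  have hx := S.x_pos.ne'
  rw [S.z_eq]
  field_simp
  linear_combination h

end Roots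

/-- The shape of the two-parameter formulas, with the constants collected. -/
theorem collect_products {u x z : ℝ} (hu : u ≠ 0) (hne : x - z ≠ 0)
    (t c₁ c₂ c₁' c₂' f g P S Q V A B : ℝ) :
    c₁ * t * u ^ 4 * (-(u * f)) / (-(u * x) - -(u * z)) ^ 2 *
          ((-(u * x) - u ^ 2) * A - (-(u * z) - u ^ 2) * P * V)
        - c₁' * t * u ^ 4 * (-(u * g)) / (-(u * x) - -(u * z)) ^ 2 *
          ((-(u * x) - u ^ 2) * S * Q - (-(u * z) - u ^ 2) * B)
        + c₂ * t * u ^ 6 * (-(u * f)) / (-(u * x) - -(u * z)) ^ 2 * (A - P * V)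
        - c₂' * t * u ^ 6 * (-(u * g)) / (-(u * x) - -(u * z)) ^ 2 * (S * Q - B) =
      (f * ((c₁ * (x + u) - u * c₂) * (t * u ^ 4) * A
          - (c₁ * (z + u) - u * c₂) * (t * u ^ 4) * (P * V))
        - g * ((c₁' * (x + u) - u * c₂') * (t * u ^ 4) * (S * Q)
          - (c₁' * (z + u) - u * c₂') * (t * u ^ 4) * B)) / (x - z) ^ 2 := by
  have e : (-(u * x) - -(u * z)) ^ 2 = u ^ 2 * (x - z) ^ 2 := by ring
  rw [e]
  field_simp
  ring

/-! ### The formulas for the minors -/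

theorem RDel_det {θ x z : ℝ} {n i j m : ℕ}
    (S : Roots (θ / n) (Real.exp (-(θ / n))) x z) (hi : 2 ≤ i) (him : i ≤ m) (hj : 2 ≤ j)
    (hjm : j ≤ m) :
    (RDel θ n (i + 1) (j + 1) m).det = (-1) ^ (i + j) *
      cofac (Real.exp (-(θ / n))) ((1 + θ / n) * Real.exp (-(θ / n)))
        (tau (θ / n) (Real.exp (-(θ / n))) (-1))
        (1 - Real.exp (-(θ / n)) ^ 4 - 4 * Real.exp (-(θ / n)) ^ 2 * (θ / n)) (m + 1) j i := by
  have h := det_corrMat_submatrix rfl (tau_neg_one _ _) rfl S.offDiag_ne S.t_pos.ne' S.lead_ne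
    (by omega : 1 ≤ m) (i := ⟨i, by omega⟩) (j := ⟨j, by omega⟩) hi hj
  rw [← h, RDel, ← skip_eq_succAbove, ← skip_eq_succAbove]
  rfl

theorem RDel_det_of_lt (θ : ℝ) (n : ℕ) {i j m : ℕ} (hi : m < i) (hj : m < j) :
    (RDel θ n i j m).det = (R θ n m).det := by
  congr 1
  ext k l
  have hk : (k : ℕ) + 1 < i := by omega
  have hl : (l : ℕ) + 1 < j := by omega
  simp [RDel, R, skip, hk, hl]

section Minors

variable {w u x z : ℝ}

theorem neg_mul_sub_neg_mul (u x z : ℝ) : -(u * x) - -(u * z) = -(u * (x - z)) := by ring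

/-- In this and the following formulas `p = i - 3`, so position `p + 2` counted from 0 is `i`
counted from 1. Where they occur, `q` is `j - i - 2`, and `s` is `m - i - 1`, or `n - j - 1` in
`cofac_far_eq`. -/
theorem cofac_diag_last (S : Roots w u x z) (p : ℕ) :
    cofac u ((1 + w) * u) (tau w u (-1)) (1 - u ^ 4 - 4 * u ^ 2 * w) (p + 4) (p + 2) (p + 2) =
      C7 w u (-(u * x)) * (coefATilde w u * -(u * x) + u ^ 2 * coefBTilde w u) /
          (-(u * x) - -(u * z)) * (tau w u (-1) * x) ^ p
        - C7 w u (-(u * z)) * (coefATilde w u * -(u * z) + u ^ 2 * coefBTilde w u) /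
          (-(u * x) - -(u * z)) * (tau w u (-1) * z) ^ p := by
  have ht := S.t_pos.ne'
  have hu := S.u_pos.ne'
  have hx := S.x_pos.ne'
  have hx1 := S.sq_sub_one_ne
  have h0 : x - z ≠ 0 := sub_ne_zero.2 S.ne
  have hR := filtT_solR_closed (u := u) (c := (1 + w) * u) S.mul_eq S.ne S.diag_eq ht (p + 1) 0
  rw [show p + 1 + 1 + 2 + 0 = p + 4 by ring] at hR
  rw [cofac_diag S.offDiag_ne ht (by omega), hR, filtT_solL_closed ht S.mul_eq S.ne S.diag_eq,
    show p + 4 = p + 2 + 2 by ring, lead_closed S.mul_eq S.ne S.diag_eq, S.C7_eq, S.symm.C7_eq,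
    weight_eq, weight_eq, neg_mul_sub_neg_mul u x z, S.diag_eq, mul_pow (tau w u (-1)) x p,
        mul_pow (tau w u (-1)) z p]
  have hz := S.z_eq
  generalize tau w u (-1) = t at *
  generalize 1 - ((1 + w) * u) ^ 2 = D
  -- With the powers of exponent `p` made independent variables, a rational identity in `x` remains,
  -- up to the sign `(-1) ^ p`.
  simp only [pow_add]
  generalize x ^ p = P
  generalize z ^ p = Q
  subst hz
  rcases neg_one_pow_eq_or ℝ p with h | h <;> rw [h] <;> field_simp <;> ring

theorem cofac_adjacent_last (S : Roots w u x z) (p : ℕ) :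
    -cofac u ((1 + w) * u) (tau w u (-1)) (1 - u ^ 4 - 4 * u ^ 2 * w) (p + 4) (p + 3) (p + 2) =
      C3 w u (-(u * x)) * (coefATilde w u * -(u * x) + u ^ 2 * coefBTilde w u) /
          (-(u * x) - -(u * z)) * (tau w u (-1) * x) ^ p
        - C3 w u (-(u * z)) * (coefATilde w u * -(u * z) + u ^ 2 * coefBTilde w u) /
          (-(u * x) - -(u * z)) * (tau w u (-1) * z) ^ p := by
  have ht := S.t_pos.ne'
  have hu := S.u_pos.ne'
  have hx := S.x_pos.ne'
  have hx1 := S.sq_sub_one_ne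
  have h0 : x - z ≠ 0 := sub_ne_zero.2 S.ne
  rw [cofac_adjacent S.offDiag_ne ht (by omega), filtT_solR_last u _ _ _ (p + 2),
    filtT_solL_closed ht S.mul_eq S.ne S.diag_eq,
    show p + 4 = p + 2 + 2 by ring, lead_closed S.mul_eq S.ne S.diag_eq, S.C3_eq, S.symm.C3_eq,
    weight_eq, weight_eq, neg_mul_sub_neg_mul u x z, mul_pow (tau w u (-1)) x p, mul_pow
        (tau w u (-1)) z p]
  have hz := S.z_eq
  generalize tau w u (-1) = t at *
  generalize 1 - ((1 + w) * u) ^ 2 = D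
  simp only [pow_add]
  generalize x ^ p = P
  generalize z ^ p = Q
  subst hz
  rcases neg_one_pow_eq_or ℝ p with h | h <;> rw [h] <;> field_simp <;> ring

theorem cofac_far_last (S : Roots w u x z) (p q : ℕ) :
    (-1) ^ q * cofac u ((1 + w) * u) (tau w u (-1)) (1 - u ^ 4 - 4 * u ^ 2 * w) (p + 5 + q) (p
        + 2 + 2 + q)
        (p + 2) =
      C6 w u (-(u * x)) * tau w u (-1) ^ q * (coefATilde w u * -(u * x) + u ^ 2 * coefBTilde w u) /
          (-(u * x) - -(u * z)) * (tau w u (-1) * x) ^ p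
        - C6 w u (-(u * z)) * tau w u (-1) ^ q * (coefATilde w u * -(u * z)
          + u ^ 2 * coefBTilde w u) /
          (-(u * x) - -(u * z)) * (tau w u (-1) * z) ^ p := by
  have ht := S.t_pos.ne'
  have hu := S.u_pos.ne'
  have hx := S.x_pos.ne'
  have hx1 := S.sq_sub_one_ne
  have h0 : x - z ≠ 0 := sub_ne_zero.2 S.ne
  have hR := filtT_solR_last u ((1 + w) * u) (tau w u (-1)) (1 - u ^ 4 - 4 * u ^ 2 * w) (p + 3 + q)
  rw [show p + 3 + q + 2 = p + 5 + q by ring, show p + 3 + q + 1 = p + 2 + 2 + q by ring] at hR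
  rw [cofac_far, hR, filtT_solL_closed ht S.mul_eq S.ne S.diag_eq, S.C6_eq, S.symm.C6_eq,
    weight_eq, weight_eq, neg_mul_sub_neg_mul u x z, mul_pow (tau w u (-1)) x p, mul_pow
        (tau w u (-1)) z p]
  have hz := S.z_eq
  generalize tau w u (-1) = t at *
  generalize 1 - ((1 + w) * u) ^ 2 = D
  simp only [pow_add]
  generalize x ^ p = P
  generalize z ^ p = Q
  subst hz
  rcases neg_one_pow_eq_or ℝ p with h | h <;> rcases neg_one_pow_eq_or ℝ q with h' | h' <;>
    rw [h, h'] <;> field_simp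

/-- The square `(x + u) ^ 2` is `x ^ 2 * (1 + u z) ^ 2`, the factor that filtering the right
solution produces. -/
theorem coefA_coefB_eq (S : Roots w u x z) :
    coefA w u * -(u * x) + u ^ 2 * coefB w u = -(u * tau w u (-1) * (x + u) ^ 2) := by
  linear_combination -(u * x) * coefA_sub w u - u * x * S.diag_eq + u * mul_coefB_add w u
    - u * tau w u (-1) * S.mul_eq

theorem cofac_far_eq (S : Roots w u x z) (p q s : ℕ) :
    (-1) ^ q * cofac u ((1 + w) * u) (tau w u (-1)) (1 - u ^ 4 - 4 * u ^ 2 * w) (p + 6 + q + s)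
        (p + 2 + 2 + q) (p + 2) =
      C6 w u (-(u * x)) * tau w u (-1) ^ q * (coefATilde w u * -(u * x) + u ^ 2 * coefBTilde w u) /
          (-(u * x) - -(u * z)) ^ 2 *
          ((coefA w u * -(u * x) + u ^ 2 * coefB w u) * (tau w u (-1) * x) ^ (p + s)
            - (coefA w u * -(u * z) + u ^ 2 * coefB w u) * (tau w u (-1) * x) ^ p
              * (tau w u (-1) * z) ^ s)
        - C6 w u (-(u * z)) * tau w u (-1) ^ q * (coefATilde w u * -(u * z)
          + u ^ 2 * coefBTilde w u) /
          (-(u * x) - -(u * z)) ^ 2 *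
          ((coefA w u * -(u * x) + u ^ 2 * coefB w u) * (tau w u (-1) * x) ^ s
              * (tau w u (-1) * z) ^ p
            - (coefA w u * -(u * z) + u ^ 2 * coefB w u) * (tau w u (-1) * z) ^ (p + s)) := by
  have ht := S.t_pos.ne'
  have hu := S.u_pos.ne'
  have hx := S.x_pos.ne'
  have hx1 := S.sq_sub_one_ne
  have h0 : x - z ≠ 0 := sub_ne_zero.2 S.ne
  have hR := filtT_solR_closed (u := u) (c := (1 + w) * u) S.mul_eq S.ne S.diag_eq ht (p + 3 + q) s
  rw [show p + 3 + q + 1 + 2 + s = p + 6 + q + s by ring,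
    show p + 3 + q + 1 = p + 2 + 2 + q by ring] at hR
  rw [cofac_far, hR, filtT_solL_closed ht S.mul_eq S.ne S.diag_eq, S.C6_eq, S.symm.C6_eq,
    weight_eq, weight_eq, coefA_coefB_eq S, coefA_coefB_eq S.symm, neg_mul_sub_neg_mul u x z]
  simp only [mul_pow (tau w u (-1)) x, mul_pow (tau w u (-1)) z]
  have hz := S.z_eq
  generalize tau w u (-1) = t at *
  generalize 1 - ((1 + w) * u) ^ 2 = D
  simp only [pow_add]
  generalize x ^ p = P
  generalize z ^ p = Q
  generalize x ^ s = X
  generalize z ^ s = Z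
  subst hz
  rcases neg_one_pow_eq_or ℝ p with h | h <;> rcases neg_one_pow_eq_or ℝ q with h' | h' <;>
    rw [h, h'] <;> field_simp <;> ring

theorem cofac_diag_eq (S : Roots w u x z) (p s : ℕ) :
    cofac u ((1 + w) * u) (tau w u (-1)) (1 - u ^ 4 - 4 * u ^ 2 * w) (p + 5 + s) (p + 2)
        (p + 2) =
      C1 w u (-(u * x)) * tau w u (-1) * u ^ 4 * (coefATilde w u * -(u * x)
        + u ^ 2 * coefBTilde w u) /
          (-(u * x) - -(u * z)) ^ 2 *
          ((-(u * x) - u ^ 2) * (tau w u (-1) * x) ^ (p + s)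
            - (-(u * z) - u ^ 2) * (tau w u (-1) * x) ^ p * (tau w u (-1) * z) ^ s)
        - C1 w u (-(u * z)) * tau w u (-1) * u ^ 4 * (coefATilde w u * -(u * z)
          + u ^ 2 * coefBTilde w u) /
          (-(u * x) - -(u * z)) ^ 2 *
          ((-(u * x) - u ^ 2) * (tau w u (-1) * x) ^ s * (tau w u (-1) * z) ^ p
            - (-(u * z) - u ^ 2) * (tau w u (-1) * z) ^ (p + s))
        + C2 w u (-(u * x)) * tau w u (-1) * u ^ 6 * (coefATilde w u * -(u * x)
          + u ^ 2 * coefBTilde w u) /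
          (-(u * x) - -(u * z)) ^ 2 *
          ((tau w u (-1) * x) ^ (p + s) - (tau w u (-1) * x) ^ p * (tau w u (-1) * z) ^ s)
        - C2 w u (-(u * z)) * tau w u (-1) * u ^ 6 * (coefATilde w u * -(u * z)
          + u ^ 2 * coefBTilde w u) /
          (-(u * x) - -(u * z)) ^ 2 *
          ((tau w u (-1) * x) ^ s * (tau w u (-1) * z) ^ p - (tau w u (-1) * z) ^ (p + s)) := by
  have ht := S.t_pos.ne'
  have hu := S.u_pos.ne'
  have hx := S.x_pos.ne'
  have hx1 := S.sq_sub_one_ne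
  have h0 : x - z ≠ 0 := sub_ne_zero.2 S.ne
  have hR := filtT_solR_closed (u := u) (c := (1 + w) * u) S.mul_eq S.ne S.diag_eq ht (p + 1)
    (s + 1)
  rw [show p + 1 + 1 + 2 + (s + 1) = p + 5 + s by ring] at hR
  rw [weight_eq, weight_eq, collect_products hu h0, S.C1_C2_outer, S.C1_C2_inner,
      S.symm.C1_C2_outer,
    S.symm.C1_C2_inner, cofac_diag S.offDiag_ne ht (by omega),
    hR, filtT_solL_closed ht S.mul_eq S.ne S.diag_eq,
    show p + 5 + s = p + 3 + s + 2 by ring, lead_closed S.mul_eq S.ne S.diag_eq]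
  simp only [S.diag_eq, mul_pow (tau w u (-1)) x, mul_pow (tau w u (-1)) z]
  have hz := S.z_eq
  generalize tau w u (-1) = t at *
  generalize 1 - ((1 + w) * u) ^ 2 = D
  simp only [pow_add]
  generalize x ^ p = P
  generalize z ^ p = Q
  generalize x ^ s = X
  generalize z ^ s = Z
  subst hz
  rcases neg_one_pow_eq_or ℝ p with h | h <;> rw [h] <;> field_simp <;> ring

theorem cofac_adjacent_eq (S : Roots w u x z) (p s : ℕ) :
    -cofac u ((1 + w) * u) (tau w u (-1)) (1 - u ^ 4 - 4 * u ^ 2 * w) (p + 5 + s) (p + 3)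
        (p + 2) =
      C4 w u (-(u * x)) * tau w u (-1) * u ^ 4 * (coefATilde w u * -(u * x)
        + u ^ 2 * coefBTilde w u) /
          (-(u * x) - -(u * z)) ^ 2 *
          ((-(u * x) - u ^ 2) * (tau w u (-1) * x) ^ (p + s)
            - (-(u * z) - u ^ 2) * (tau w u (-1) * x) ^ p * (tau w u (-1) * z) ^ s)
        - C4 w u (-(u * z)) * tau w u (-1) * u ^ 4 * (coefATilde w u * -(u * z)
          + u ^ 2 * coefBTilde w u) /
          (-(u * x) - -(u * z)) ^ 2 *
          ((-(u * x) - u ^ 2) * (tau w u (-1) * x) ^ s * (tau w u (-1) * z) ^ p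
            - (-(u * z) - u ^ 2) * (tau w u (-1) * z) ^ (p + s))
        + C5 w u (-(u * x)) * tau w u (-1) * u ^ 6 * (coefATilde w u * -(u * x)
          + u ^ 2 * coefBTilde w u) /
          (-(u * x) - -(u * z)) ^ 2 *
          ((tau w u (-1) * x) ^ (p + s) - (tau w u (-1) * x) ^ p * (tau w u (-1) * z) ^ s)
        - C5 w u (-(u * z)) * tau w u (-1) * u ^ 6 * (coefATilde w u * -(u * z)
          + u ^ 2 * coefBTilde w u) /
          (-(u * x) - -(u * z)) ^ 2 *
          ((tau w u (-1) * x) ^ s * (tau w u (-1) * z) ^ p - (tau w u (-1) * z) ^ (p + s)) := by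
  have ht := S.t_pos.ne'
  have hu := S.u_pos.ne'
  have hx := S.x_pos.ne'
  have hx1 := S.sq_sub_one_ne
  have h0 : x - z ≠ 0 := sub_ne_zero.2 S.ne
  have hR := filtT_solR_closed (u := u) (c := (1 + w) * u) S.mul_eq S.ne S.diag_eq ht (p + 2) s
  rw [show p + 2 + 1 + 2 + s = p + 5 + s by ring] at hR
  rw [weight_eq, weight_eq, collect_products hu h0, S.C4_C5_outer, S.C4_C5_inner,
      S.symm.C4_C5_outer,
    S.symm.C4_C5_inner, cofac_adjacent S.offDiag_ne ht (by omega),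
    hR, filtT_solL_closed ht S.mul_eq S.ne S.diag_eq,
    show p + 5 + s = p + 3 + s + 2 by ring, lead_closed S.mul_eq S.ne S.diag_eq]
  simp only [mul_pow (tau w u (-1)) x, mul_pow (tau w u (-1)) z]
  have hz := S.z_eq
  generalize tau w u (-1) = t at *
  generalize 1 - ((1 + w) * u) ^ 2 = D
  simp only [pow_add]
  generalize x ^ p = P
  generalize z ^ p = Q
  generalize x ^ s = X
  generalize z ^ s = Z
  subst hz
  rcases neg_one_pow_eq_or ℝ p with h | h <;> rw [h] <;> field_simp <;> ring

end Minors

end CovMatrix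

theorem theorem4 (θ : ℝ) (hθ : 0 < θ) (n : ℕ)
    (w u τ a b a' b' α₁ α₂ p₁ p₂ : ℝ)
    (hw : w = θ / n) (hu : u = Real.exp (-w))
    (hτ : τ = tau w u (-1))
    (ha : a = coefA w u) (hb : b = coefB w u)
    (ha' : a' = coefATilde w u) (hb' : b' = coefBTilde w u)
    (hα₁ : α₁ = alpha1 w u) (hα₂ : α₂ = alpha2 w u)
    (hp₁ : p₁ = -(b + τ * u) * α₁) (hp₂ : p₂ = -(b + τ * u) * α₂) :
    -- For `4 ≤ n` every denominator below is nonzero and the square root is that of a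
    -- positive number.
    (4 ≤ n →
      0 < discr w u ∧ b + τ * u ≠ 0 ∧ τ ≠ 0 ∧ u ≠ 0 ∧ α₁ ≠ α₂ ∧
        den w u α₁ ≠ 0 ∧ den w u α₂ ≠ 0) ∧
    -- `j = i`
    (∀ i : ℕ, 3 ≤ i → i ≤ n - 1 →
      (∀ m : ℕ, 1 ≤ m → m ≤ i - 1 → (RDel θ n i i m).det = (R θ n m).det) ∧
      (RDel θ n i i i).det =
        C7 w u α₁ * (a' * α₁ + u ^ 2 * b') / (α₁ - α₂) * p₁ ^ (i - 3)
          - C7 w u α₂ * (a' * α₂ + u ^ 2 * b') / (α₁ - α₂) * p₂ ^ (i - 3) ∧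
      (∀ m : ℕ, i + 1 ≤ m → m ≤ n - 1 →
        (RDel θ n i i m).det =
          C1 w u α₁ * τ * u ^ 4 * (a' * α₁ + u ^ 2 * b') / (α₁ - α₂) ^ 2 *
              ((α₁ - u ^ 2) * p₁ ^ (m - 4)
                - (α₂ - u ^ 2) * p₁ ^ (i - 3) * p₂ ^ (m - i - 1))
            - C1 w u α₂ * τ * u ^ 4 * (a' * α₂ + u ^ 2 * b') / (α₁ - α₂) ^ 2 *
              ((α₁ - u ^ 2) * p₁ ^ (m - i - 1) * p₂ ^ (i - 3)
                - (α₂ - u ^ 2) * p₂ ^ (m - 4))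
            + C2 w u α₁ * τ * u ^ 6 * (a' * α₁ + u ^ 2 * b') / (α₁ - α₂) ^ 2 *
              (p₁ ^ (m - 4) - p₁ ^ (i - 3) * p₂ ^ (m - i - 1))
            - C2 w u α₂ * τ * u ^ 6 * (a' * α₂ + u ^ 2 * b') / (α₁ - α₂) ^ 2 *
              (p₁ ^ (m - i - 1) * p₂ ^ (i - 3) - p₂ ^ (m - 4)))) ∧
    -- `j = i + 1`
    (∀ i : ℕ, 3 ≤ i → i ≤ n - 1 →
      (∀ m : ℕ, 1 ≤ m → m ≤ i - 1 → (RDel θ n i (i + 1) m).det = (R θ n m).det) ∧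
      (RDel θ n i (i + 1) i).det =
        C3 w u α₁ * (a' * α₁ + u ^ 2 * b') / (α₁ - α₂) * p₁ ^ (i - 3)
          - C3 w u α₂ * (a' * α₂ + u ^ 2 * b') / (α₁ - α₂) * p₂ ^ (i - 3) ∧
      (∀ m : ℕ, i + 1 ≤ m → m ≤ n - 1 →
        (RDel θ n i (i + 1) m).det =
          C4 w u α₁ * τ * u ^ 4 * (a' * α₁ + u ^ 2 * b') / (α₁ - α₂) ^ 2 *
              ((α₁ - u ^ 2) * p₁ ^ (m - 4)
                - (α₂ - u ^ 2) * p₁ ^ (i - 3) * p₂ ^ (m - i - 1))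
            - C4 w u α₂ * τ * u ^ 4 * (a' * α₂ + u ^ 2 * b') / (α₁ - α₂) ^ 2 *
              ((α₁ - u ^ 2) * p₁ ^ (m - i - 1) * p₂ ^ (i - 3)
                - (α₂ - u ^ 2) * p₂ ^ (m - 4))
            + C5 w u α₁ * τ * u ^ 6 * (a' * α₁ + u ^ 2 * b') / (α₁ - α₂) ^ 2 *
              (p₁ ^ (m - 4) - p₁ ^ (i - 3) * p₂ ^ (m - i - 1))
            - C5 w u α₂ * τ * u ^ 6 * (a' * α₂ + u ^ 2 * b') / (α₁ - α₂) ^ 2 *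
              (p₁ ^ (m - i - 1) * p₂ ^ (i - 3) - p₂ ^ (m - 4)))) ∧
    -- `j = n`
    (∀ i : ℕ, 3 ≤ i → i ≤ n - 2 →
      (RDel θ n i n (n - 1)).det =
        C6 w u α₁ * τ ^ (n - i - 2) * (a' * α₁ + u ^ 2 * b') / (α₁ - α₂) * p₁ ^ (i - 3)
          - C6 w u α₂ * τ ^ (n - i - 2) * (a' * α₂ + u ^ 2 * b') / (α₁ - α₂) *
            p₂ ^ (i - 3)) ∧
    -- `i + 2 ≤ j ≤ n - 1`
    (∀ i j : ℕ, 3 ≤ i → i + 2 ≤ j → j ≤ n - 1 →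
      (RDel θ n i j (n - 1)).det =
        C6 w u α₁ * τ ^ (j - i - 2) * (a' * α₁ + u ^ 2 * b') / (α₁ - α₂) ^ 2 *
            ((a * α₁ + u ^ 2 * b) * p₁ ^ (n - j + i - 4)
              - (a * α₂ + u ^ 2 * b) * p₁ ^ (i - 3) * p₂ ^ (n - j - 1))
          - C6 w u α₂ * τ ^ (j - i - 2) * (a' * α₂ + u ^ 2 * b') / (α₁ - α₂) ^ 2 *
            ((a * α₁ + u ^ 2 * b) * p₁ ^ (n - j - 1) * p₂ ^ (i - 3)
              - (a * α₂ + u ^ 2 * b) * p₂ ^ (n - j + i - 4))) := by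
  have hdet0 : ∀ i j m : ℕ, m < i → m < j → (RDel θ n i j m).det = (R θ n m).det :=
    fun i j m hi hj => RDel_det_of_lt θ n hi hj
  have main : 4 ≤ n → ∃ x z, Roots w u x z ∧ 0 < discr w u ∧ α₁ = -(u * x) ∧ α₂ = -(u * z) := by
    intro hn
    have hwpos : 0 < w := by
      rw [hw]
      have : (0 : ℝ) < n := by exact_mod_cast (by omega : 0 < n)
      positivity
    obtain ⟨x, z, S, hΔ, h1, h2⟩ := exists_roots hwpos
    rw [hu]
    exact ⟨x, z, S, hΔ, by rw [hα₁, hu, h1], by rw [hα₂, hu, h2]⟩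
  have hdet : ∀ {x z}, Roots w u x z → ∀ i j m : ℕ, 2 ≤ i → i ≤ m → 2 ≤ j → j ≤ m →
      (RDel θ n (i + 1) (j + 1) m).det = (-1) ^ (i + j) *
        cofac u ((1 + w) * u) (tau w u (-1)) (1 - u ^ 4 - 4 * u ^ 2 * w) (m + 1) j i := by
    intro x z S i j m hi him hj hjm
    subst hu hw
    exact RDel_det S hi him hj hjm
  have hroot : ∀ {x z}, Roots w u x z → α₁ = -(u * x) → α₂ = -(u * z) →
      p₁ = τ * x ∧ p₂ = τ * z := by
    intro x z S h1 h2
    have := mul_coefB_add w u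
    rw [← hτ, ← hb] at this
    constructor
    · rw [hp₁, h1]
      linear_combination x * this
    · rw [hp₂, h2]
      linear_combination z * this
  refine ⟨fun hn => ?_, fun i hi hin => ?_, fun i hi hin => ?_, fun i hi hin => ?_,
    fun i j hi hij hjn => ?_⟩
  · obtain ⟨x, z, S, hΔ, h1, h2⟩ := main hn
    have hne : u * (b + τ * u) ≠ 0 := by
      rw [hb, hτ, mul_coefB_add]
      exact S.t_pos.ne'
    refine ⟨hΔ, right_ne_zero_of_mul hne, hτ ▸ S.t_pos.ne', S.u_pos.ne', ?_, h1 ▸ S.den_ne,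
      h2 ▸ S.symm.den_ne⟩
    rw [h1, h2]
    exact fun h => S.ne (mul_left_cancel₀ S.u_pos.ne' (neg_injective h))
  · obtain ⟨x, z, S, -, h1, h2⟩ := main (by omega)
    obtain ⟨hp1, hp2⟩ := hroot S h1 h2
    obtain ⟨p, rfl⟩ := Nat.exists_eq_add_of_le' hi
    refine ⟨fun m _ hm => hdet0 _ _ _ (by omega) (by omega), ?_, fun m hm hmn => ?_⟩
    · rw [hdet S (p + 2) (p + 2) (p + 3) (by omega) (by omega) (by omega) (by omega),
        Even.neg_one_pow ⟨_, rfl⟩, one_mul, cofac_diag_last S p, hp1, hp2, h1, h2, ha', hb', hτ]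
      rfl
    · obtain ⟨s, rfl⟩ := Nat.exists_eq_add_of_le hm
      rw [hdet S (p + 2) (p + 2) (p + 3 + 1 + s) (by omega) (by omega) (by omega) (by omega),
        Even.neg_one_pow ⟨_, rfl⟩, one_mul, show p + 3 + 1 + s + 1 = p + 5 + s by ring,
        cofac_diag_eq S p s, hp1, hp2, h1, h2, ha', hb', hτ,
        show p + 3 + 1 + s - 4 = p + s by omega, show p + 3 - 3 = p by omega,
        show p + 3 + 1 + s - (p + 3) - 1 = s by omega]
  · obtain ⟨x, z, S, -, h1, h2⟩ := main (by omega)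
    obtain ⟨hp1, hp2⟩ := hroot S h1 h2
    obtain ⟨p, rfl⟩ := Nat.exists_eq_add_of_le' hi
    have hodd : Odd (p + 2 + (p + 3)) := ⟨p + 2, by ring⟩
    refine ⟨fun m _ hm => hdet0 _ _ _ (by omega) (by omega), ?_, fun m hm hmn => ?_⟩
    · rw [hdet S (p + 2) (p + 3) (p + 3) (by omega) (by omega) (by omega) (by omega),
        hodd.neg_one_pow, neg_one_mul, cofac_adjacent_last S p, hp1, hp2, h1, h2, ha', hb', hτ]
      rfl
    · obtain ⟨s, rfl⟩ := Nat.exists_eq_add_of_le hm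
      rw [hdet S (p + 2) (p + 3) (p + 3 + 1 + s) (by omega) (by omega) (by omega) (by omega),
        hodd.neg_one_pow, neg_one_mul, show p + 3 + 1 + s + 1 = p + 5 + s by ring,
        cofac_adjacent_eq S p s, hp1, hp2, h1, h2, ha', hb', hτ,
        show p + 3 + 1 + s - 4 = p + s by omega, show p + 3 - 3 = p by omega,
        show p + 3 + 1 + s - (p + 3) - 1 = s by omega]
  · obtain ⟨x, z, S, -, h1, h2⟩ := main (by omega)
    obtain ⟨hp1, hp2⟩ := hroot S h1 h2
    obtain ⟨p, rfl⟩ := Nat.exists_eq_add_of_le' hi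
    obtain ⟨q, hq⟩ := Nat.exists_eq_add_of_le (by omega : p + 3 + 2 ≤ n)
    have hd := hdet S (p + 2) (p + 2 + 2 + q) (n - 1) (by omega) (by omega) (by omega) (by omega)
    -- The cofactor sign depends only on the parity of `j - i`, which is that of `q`.
    have hsign : (-1 : ℝ) ^ (p + 2 + (p + 2 + 2 + q)) = (-1) ^ q := by
      rw [show p + 2 + (p + 2 + 2 + q) = (p + 3) + (p + 3) + q by ring, pow_add,
        Even.neg_one_pow ⟨_, rfl⟩, one_mul]
    rw [show p + 2 + 2 + q + 1 = n by omega, hsign, show n - 1 + 1 = p + 5 + q by omega,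
      cofac_far_last S p q] at hd
    rw [hd, hp1, hp2, h1, h2, ha', hb', hτ, show n - (p + 3) - 2 = q by omega,
      show p + 3 - 3 = p by omega]
  · obtain ⟨x, z, S, -, h1, h2⟩ := main (by omega)
    obtain ⟨hp1, hp2⟩ := hroot S h1 h2
    obtain ⟨p, rfl⟩ := Nat.exists_eq_add_of_le' hi
    obtain ⟨q, rfl⟩ := Nat.exists_eq_add_of_le hij
    obtain ⟨s, hs⟩ := Nat.exists_eq_add_of_le (by omega : p + 3 + 2 + q + 1 ≤ n)
    have hd := hdet S (p + 2) (p + 2 + 2 + q) (n - 1) (by omega) (by omega) (by omega) (by omega)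
    have hsign : (-1 : ℝ) ^ (p + 2 + (p + 2 + 2 + q)) = (-1) ^ q := by
      rw [show p + 2 + (p + 2 + 2 + q) = (p + 3) + (p + 3) + q by ring, pow_add,
        Even.neg_one_pow ⟨_, rfl⟩, one_mul]
    rw [show p + 2 + 2 + q + 1 = p + 3 + 2 + q by omega, hsign,
      show n - 1 + 1 = p + 6 + q + s by omega, cofac_far_eq S p q s] at hd
    rw [hd, hp1, hp2, h1, h2, ha, hb, ha', hb', hτ,
      show p + 3 + 2 + q - (p + 3) - 2 = q by omega,
      show n - (p + 3 + 2 + q) + (p + 3) - 4 = p + s by omega,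
      show n - (p + 3 + 2 + q) - 1 = s by omega, show p + 3 - 3 = p by omega]
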